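/- **Model.** Randomized word RAM with $O(\log n)$-bit words: for a constant $c$ of the algorithm, words have $c(\lfloor\log_2 n\rfloor+1)$ bits. Running times are worst case; error probabilities are over the algorithm's coins, for every fixed input and every fixed sequence of queries. **OMv conjecture.** In OMv one is given $n\ge 1$ and a Boolean $n\times n$ matrix $M$, then $n$ Boolean vectors $v_1,\dots,v_n$ one at a time, and has to output the Boolean product $Mv_t$ before $v_{t+1}$ is revealed. The conjecture says: for no constant $\epsilon>0$ is there an algorithm that solves OMv in total time $O(n^{3-\epsilon})$ with probability at most $1/3$ that some output is wrong. **TreeFlow.** The input is an undirected graph $G=(V,E)$ with $|V|=n$, a rooted spanning tree $T$ of $G$, resistances $r(u,v)>0$ for $(u,v)\in E$, and supplies $b(v)$ for $v\in V$ with $\sum_v b(v)=0$. Every vertex has a nonnegative value $\mathrm{value}(v)$, initially $0$. For $C\subseteq V$ put $$S(C)=\sum_{v\in C}b(v),\qquad f(C)=\sum_{(u,v)\in E,\ u\in C,\ v\notin C}\frac{\mathrm{value}(u)-\mathrm{value}(v)}{r(u,v)}.$$ The operation $\mathsf{addvalue}(v,x)$ adds $x$ to the value of every vertex in the subtree of $T$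 rooted at $v$. The operation $\mathsf{findflow}(v)$ of an *$\alpha$-approximate* TreeFlow data structure returns a number between $(S(C)-f(C))/\alpha$ and $(S(C)-f(C))\cdot\alpha$, where $C$ is the vertex set of the subtree of $T$ rooted at $v$. All resistances, supplies, arguments $x$, vertex values and exact answers $S(C)-f(C)$ are rationals whose numerators and denominators have at most $a(\lfloor\log_2 n\rfloor+1)$ bits, for a constant $a\ge1$; the data structure only has to work on inputs and operation sequences with this property that keep all vertex values nonnegative. **Lemma.** Let $\epsilon>0$ be a constant, let $\alpha=\alpha(n)\ge 1$ be any function of $n$, and let $a\ge 1$ and $k\ge 2$ be integer constants. Assume the OMv conjecture. Then there is no implementation of the $\alpha$-approximate TreeFlow data structure that uses preprocessing time $O(n^{3-\epsilon})$ and in which $\mathsf{addvalue}$ and $\mathsf{findflow}$ both take time $O(n^{1-\epsilon})$ per operation, such that over every sequence of at most $n^k$ operations the probability that some answer of $\mathsf{findflow}$ is wrong is at most $1/3$. -/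

import Mathlib

/-! ### A randomized word RAM

Programs are finite structured programs over registers and arrays of nonnegative integers.  A run is
relative to a word bound `B` (for words of `w` bits, `B = 2 ^ w`): every number written by an
instruction has to be smaller than `B`, otherwise there is no run.  Every instruction and every test
costs one time step.  Registers and arrays are named by constants in the program, so that a program
uses only finitely many of them; cells of an array are addressed by the content of a register. -/

/-- The word operations; the two comparisons return `1` for true and `0` for false. -/
inductive WordOp
  | add | sub | mul | div | mod | and | or | xor | shl | shr | lt | eq

/-- The value of a word operation (before the check that it fits into a word). -/
def WordOp.eval : WordOp → ℕ → ℕ → ℕ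
  | .add, x, y => x + y
  | .sub, x, y => x - y
  | .mul, x, y => x * y
  | .div, x, y => x / y
  | .mod, x, y => x % y
  | .and, x, y => x &&& y
  | .or, x, y => x ||| y
  | .xor, x, y => x ^^^ y
  | .shl, x, y => x <<< y
  | .shr, x, y => x >>> y
  | .lt, x, y => if x < y then 1 else 0
  | .eq, x, y => if x = y then 1 else 0

/-- Word RAM programs.  Registers are written `d`, `i`, `j`, `l`; `a` is the name of an array.
`rand d l` puts into `d` a word made of as many fresh random bits as the content of `l` says. -/
inductive Cmd
  | skip
  | const (d k : ℕ)
  | op (o : WordOp) (d i j : ℕ)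
  | load (d a i : ℕ)
  | store (a i j : ℕ)
  | rand (d l : ℕ)
  | seq (p q : Cmd)
  | ite (i : ℕ) (p q : Cmd)
  | while (i : ℕ) (p : Cmd)

/-- A machine state: registers, arrays, and the number of random bits consumed so far. -/
structure RamState where
  reg : ℕ → ℕ
  mem : ℕ → ℕ → ℕ
  used : ℕ

namespace RamState

/-- All registers and all array cells are `0`, no random bit is used up. -/
def zero : RamState := ⟨fun _ => 0, fun _ _ => 0, 0⟩

def setReg (s : RamState) (d x : ℕ) : RamState := { s with reg := Function.update s.reg d x }

/-- Replace the whole array `a`. -/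
def setArr (s : RamState) (a : ℕ) (f : ℕ → ℕ) : RamState :=
  { s with mem := Function.update s.mem a f }

def setCell (s : RamState) (a p x : ℕ) : RamState :=
  s.setArr a (Function.update (s.mem a) p x)

def useBits (s : RamState) (l : ℕ) : RamState := { s with used := s.used + l }

end RamState

/-- The word whose binary digits are the `l` bits of the random tape `ω` from position `p` on. -/
def tapeWord (ω : ℕ → Bool) (p l : ℕ) : ℕ := ∑ i ∈ Finset.range l, (ω (p + i)).toNat * 2 ^ i

/-- `Runs B ω p s t s'`: with word bound `B` and random tape `ω`, the program `p`, started in state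
`s`, halts after exactly `t` steps in state `s'`, and no word overflows. -/
inductive Runs (B : ℕ) (ω : ℕ → Bool) : Cmd → RamState → ℕ → RamState → Prop
  | skip (s : RamState) : Runs B ω .skip s 1 s
  | const (s : RamState) (d k : ℕ) (h : k < B) : Runs B ω (.const d k) s 1 (s.setReg d k)
  | op (s : RamState) (o : WordOp) (d i j : ℕ) (h : o.eval (s.reg i) (s.reg j) < B) :
      Runs B ω (.op o d i j) s 1 (s.setReg d (o.eval (s.reg i) (s.reg j)))
  | load (s : RamState) (d a i : ℕ) (h : s.mem a (s.reg i) < B) :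
      Runs B ω (.load d a i) s 1 (s.setReg d (s.mem a (s.reg i)))
  | store (s : RamState) (a i j : ℕ) (hi : s.reg i < B) (hj : s.reg j < B) :
      Runs B ω (.store a i j) s 1 (s.setCell a (s.reg i) (s.reg j))
  | rand (s : RamState) (d l : ℕ) (h : 2 ^ s.reg l ≤ B) :
      Runs B ω (.rand d l) s 1
        ((s.setReg d (tapeWord ω s.used (s.reg l))).useBits (s.reg l))
  | seq (p q : Cmd) (s s' s'' : RamState) (t t' : ℕ) (h : Runs B ω p s t s')
      (h' : Runs B ω q s' t' s'') : Runs B ω (.seq p q) s (t + t') s''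
  | iteTrue (i : ℕ) (p q : Cmd) (s s' : RamState) (t : ℕ) (hi : s.reg i ≠ 0)
      (h : Runs B ω p s t s') : Runs B ω (.ite i p q) s (t + 1) s'
  | iteFalse (i : ℕ) (p q : Cmd) (s s' : RamState) (t : ℕ) (hi : s.reg i = 0)
      (h : Runs B ω q s t s') : Runs B ω (.ite i p q) s (t + 1) s'
  | whileDone (i : ℕ) (p : Cmd) (s : RamState) (hi : s.reg i = 0) :
      Runs B ω (.while i p) s 1 s
  | whileStep (i : ℕ) (p : Cmd) (s s' s'' : RamState) (t t' : ℕ) (hi : s.reg i ≠ 0)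
      (h : Runs B ω p s t s') (h' : Runs B ω (.while i p) s' t' s'') :
      Runs B ω (.while i p) s (t + t' + 1) s''

/-- The number of different words of `c * (⌊log₂ n⌋ + 1)` bits; for constant `c` these are `O(log n)`-bit
words. -/
def wordBound (c n : ℕ) : ℕ := 2 ^ (c * (Nat.log 2 n + 1))

/-- The distribution of a random tape: independent fair coin flips. -/
noncomputable def coinMeasure : MeasureTheory.Measure (ℕ → Bool) :=
  MeasureTheory.Measure.infinitePi fun _ : ℕ => (PMF.uniformOfFintype Bool).toMeasure

/-- The array with contents `f 0, …, f (n - 1)`, followed by zeros. -/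
def vecArr {n : ℕ} (f : Fin n → ℕ) : ℕ → ℕ := fun p => if h : p < n then f ⟨p, h⟩ else 0

/-- The array that lists the `n × n` matrix `m` row by row: `m u v` is in cell `u * n + v`. -/
def matArr {n : ℕ} (m : Fin n → Fin n → ℕ) : ℕ → ℕ :=
  vecArr fun p : Fin (n * n) => m p.divNat p.modNat

/-! ### Online Boolean matrix-vector multiplication (OMv) -/

/-- The Boolean product `M v`: addition is "or", multiplication is "and". -/
def boolMulVec {n : ℕ} (M : Fin n → Fin n → Bool) (v : Fin n → Bool) : Fin n → Bool :=
  fun i => decide (∃ j, M i j = true ∧ v j = true)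

/-- An algorithm for OMv: a program that preprocesses the matrix, and a program that is run for
every vector of the online sequence on the state left by the previous run. -/
structure OMvAlg where
  prep : Cmd
  query : Cmd

namespace OMvAlg

/-- The initial state: `n` is in register `0`, the matrix in array `0`. -/
def initState {n : ℕ} (M : Fin n → Fin n → Bool) : RamState :=
  (RamState.zero.setReg 0 n).setArr 0 (matArr fun i j => (M i j).toNat)

/-- The next vector is handed over in the first `n` cells of array `1`. -/
def giveVec {n : ℕ} (v : Fin n → Bool) (s : RamState) : RamState :=
  s.setArr 1 fun p => if h : p < n then (v ⟨p, h⟩).toNat else s.mem 1 p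

/-- The answer `y` is returned in the first `n` cells of array `2`. -/
def Returns {n : ℕ} (s : RamState) (y : Fin n → Bool) : Prop :=
  ∀ i : Fin n, s.mem 2 i = (y i).toNat

/-- `A.Rounds B ω s vs t outs`: from state `s` on, the vectors `vs` arrive one after the other, each
one is processed before the next one arrives, all rounds together take `t` steps, and `outs` lists
the states at the ends of the rounds, from which the answers are read off. -/
inductive Rounds (A : OMvAlg) (B : ℕ) (ω : ℕ → Bool) {n : ℕ} :
    RamState → List (Fin n → Bool) → ℕ → List RamState → Prop
  | nil (s : RamState) : Rounds A B ω s [] 0 []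
  | cons (s s' : RamState) (v : Fin n → Bool) (vs : List (Fin n → Bool)) (t t' : ℕ)
      (outs : List RamState) (h : Runs B ω A.query (giveVec v s) t s')
      (h' : Rounds A B ω s' vs t' outs) : Rounds A B ω s (v :: vs) (t + t') (s' :: outs)

/-- A complete run on the matrix `M` and the online sequence `vs`, with total time `t`
(preprocessing included). -/
def FullRun (A : OMvAlg) (B : ℕ) (ω : ℕ → Bool) {n : ℕ} (M : Fin n → Fin n → Bool)
    (vs : List (Fin n → Bool)) (t : ℕ) (outs : List RamState) : Prop :=
  ∃ (t₁ t₂ : ℕ) (s : RamState),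
    Runs B ω A.prep (initState M) t₁ s ∧ A.Rounds B ω s vs t₂ outs ∧ t = t₁ + t₂

/-- With words of `c * (⌊log₂ n⌋ + 1)` bits, `A` always runs in total time at most `C * n ^ (3 - ε)`
on every `n × n` matrix with every sequence of `n` vectors, and the probability that not all
answers are correct is at most `1 / 3`. -/
def Solves (A : OMvAlg) (c : ℕ) (C ε : ℝ) : Prop :=
  ∀ n : ℕ, 1 ≤ n → ∀ (M : Fin n → Fin n → Bool) (vs : List (Fin n → Bool)), vs.length = n →
    (∀ ω, ∃ t outs, A.FullRun (wordBound c n) ω M vs t outs ∧ (t : ℝ) ≤ C * (n : ℝ) ^ (3 - ε)) ∧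
    coinMeasure {ω | ¬ ∃ t outs, A.FullRun (wordBound c n) ω M vs t outs ∧
      List.Forall₂ (fun s v => Returns s (boolMulVec M v)) outs vs} ≤ 1 / 3

end OMvAlg

/-- The OMv conjecture: for no constant `ε > 0` is there a randomized word RAM algorithm with
`O(log n)`-bit words that solves OMv in total time `O(n ^ (3 - ε))` with error probability at most
`1 / 3`. -/
def OMvConjecture : Prop :=
  ∀ ε : ℝ, 0 < ε → ¬ ∃ (A : OMvAlg) (c : ℕ) (C : ℝ), A.Solves c C ε

/-! ### The TreeFlow problem -/

/-- A rational number whose numerator and denominator are smaller than `B` in absolute value. -/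
def FitsIn (B : ℕ) (q : ℚ) : Prop := q.num.natAbs < B ∧ q.den < B

/-- The input of a TreeFlow data structure: a graph on `n` vertices, a rooted spanning tree, positive
resistances on the edges and supplies of total `0` on the vertices. -/
structure TreeFlowInput (n : ℕ) where
  G : SimpleGraph (Fin n)
  T : SimpleGraph (Fin n)
  root : Fin n
  r : Sym2 (Fin n) → ℚ
  b : Fin n → ℚ
  le : T ≤ G
  isTree : T.IsTree
  r_pos : ∀ e ∈ G.edgeSet, 0 < r e
  b_sum : ∑ v, b v = 0

/-- The operations of a TreeFlow data structure. -/
inductive TreeFlowOp (n : ℕ)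
  | addvalue (v : Fin n) (x : ℚ)
  | findflow (v : Fin n)

namespace TreeFlowInput

variable {n : ℕ} (I : TreeFlowInput n)

/-- The vertices of the subtree of `T` rooted at `v`: those whose path to the root contains `v`. -/
def subtree (v : Fin n) : Set (Fin n) :=
  {u | ∃ p : I.T.Walk u I.root, p.IsPath ∧ v ∈ p.support}

open Classical in
/-- The supply `S(C)` of a set of vertices. -/
noncomputable def supply (C : Set (Fin n)) : ℚ := ∑ v, if v ∈ C then I.b v else 0

open Classical in
/-- The flow `f(C)` out of a set of vertices for the vertex values `val`. -/
noncomputable def flow (val : Fin n → ℚ) (C : Set (Fin n)) : ℚ :=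
  ∑ u, ∑ v, if I.G.Adj u v ∧ u ∈ C ∧ v ∉ C then (val u - val v) / I.r s(u, v) else 0

/-- The exact answer `S(C) - f(C)` to `findflow v`, where `C` is the subtree rooted at `v`. -/
noncomputable def answer (val : Fin n → ℚ) (v : Fin n) : ℚ :=
  I.supply (I.subtree v) - I.flow val (I.subtree v)

open Classical in
/-- The vertex values after `addvalue v x`. -/
noncomputable def bump (val : Fin n → ℚ) (v : Fin n) (x : ℚ) : Fin n → ℚ :=
  fun u => if u ∈ I.subtree v then val u + x else val u

/-- The exact answers to the `findflow` operations of a sequence started with the values `val`. -/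
noncomputable def answers : (Fin n → ℚ) → List (TreeFlowOp n) → List ℚ
  | _, [] => []
  | val, .addvalue v x :: ops => answers (I.bump val v x) ops
  | val, .findflow v :: ops => I.answer val v :: answers val ops

/-- A sequence of operations is admissible if it keeps all vertex values nonnegative, and all
arguments, vertex values and exact answers are rationals that fit in `B`. -/
def Admissible (B : ℕ) : (Fin n → ℚ) → List (TreeFlowOp n) → Prop
  | _, [] => True
  | val, .addvalue v x :: ops => FitsIn B x ∧
      (∀ u, 0 ≤ I.bump val v x u ∧ FitsIn B (I.bump val v x u)) ∧
      Admissible B (I.bump val v x) ops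
  | val, .findflow v :: ops => FitsIn B (I.answer val v) ∧ Admissible B val ops

/-- All resistances and supplies fit in `B`. -/
def Fits (B : ℕ) : Prop := (∀ e ∈ I.G.edgeSet, FitsIn B (I.r e)) ∧ ∀ v, FitsIn B (I.b v)

open Classical in
/-- The input in memory.  Registers: `n` in `0`, the root in `1`.  Arrays: the adjacency matrices of
`G` and of `T` in `0` and `1`, the matrices of numerators and denominators of the resistances in `2`
and `3` (with `0` for non-edges), the signs (`1` for negative), absolute numerators and denominators
of the supplies in `4`, `5` and `6`. -/
noncomputable def initState : RamState :=
  ((((((((RamState.zero.setReg 0 n).setReg 1 I.root).setArr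
    0 (matArr fun u v => if I.G.Adj u v then 1 else 0)).setArr
    1 (matArr fun u v => if I.T.Adj u v then 1 else 0)).setArr
    2 (matArr fun u v => if I.G.Adj u v then (I.r s(u, v)).num.natAbs else 0)).setArr
    3 (matArr fun u v => if I.G.Adj u v then (I.r s(u, v)).den else 0)).setArr
    4 (vecArr fun v => if I.b v < 0 then 1 else 0)).setArr
    5 (vecArr fun v => (I.b v).num.natAbs)).setArr
    6 (vecArr fun v => (I.b v).den)

end TreeFlowInput

/-- An implementation of a TreeFlow data structure: a program for the preprocessing and one for each
of the two operations, which run on the state left by the previous run. -/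
structure TreeFlowDS where
  prep : Cmd
  add : Cmd
  find : Cmd

namespace TreeFlowDS

/-- The arguments of `addvalue v x`: `v` in register `0`, the sign (`1` for negative), absolute
numerator and denominator of `x` in registers `1`, `2` and `3`. -/
def giveAdd {n : ℕ} (v : Fin n) (x : ℚ) (s : RamState) : RamState :=
  (((s.setReg 0 v).setReg 1 (if x < 0 then 1 else 0)).setReg 2 x.num.natAbs).setReg 3 x.den

/-- The argument of `findflow v`: `v` in register `0`. -/
def giveFind {n : ℕ} (v : Fin n) (s : RamState) : RamState := s.setReg 0 v

/-- The answer of `findflow` is a fraction with sign (nonzero for negative), absolute numerator and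
denominator in registers `1`, `2` and `3`. -/
def Returns (s : RamState) (q : ℚ) : Prop :=
  s.reg 3 ≠ 0 ∧ q = (if s.reg 1 = 0 then 1 else -1) * ((s.reg 2 : ℚ) / (s.reg 3 : ℚ))

/-- `D.Serves B ω τ s ops outs`: from state `s` on, the operations `ops` are carried out one after
the other, each of them in at most `τ` steps, and `outs` lists the states at the ends of the
`findflow` operations, from which the answers are read off. -/
inductive Serves (D : TreeFlowDS) (B : ℕ) (ω : ℕ → Bool) (τ : ℝ) {n : ℕ} :
    RamState → List (TreeFlowOp n) → List RamState → Prop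
  | nil (s : RamState) : Serves D B ω τ s [] []
  | addvalue (s s' : RamState) (v : Fin n) (x : ℚ) (t : ℕ) (ops : List (TreeFlowOp n))
      (outs : List RamState) (h : Runs B ω D.add (giveAdd v x s) t s') (ht : (t : ℝ) ≤ τ)
      (h' : Serves D B ω τ s' ops outs) : Serves D B ω τ s (.addvalue v x :: ops) outs
  | findflow (s s' : RamState) (v : Fin n) (t : ℕ) (ops : List (TreeFlowOp n))
      (outs : List RamState) (h : Runs B ω D.find (giveFind v s) t s') (ht : (t : ℝ) ≤ τ)
      (h' : Serves D B ω τ s' ops outs) : Serves D B ω τ s (.findflow v :: ops) (s' :: outs)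

/-- A complete run on the input `I` and the sequence `ops`, with preprocessing in at most `π` steps
and every operation in at most `τ` steps. -/
def FullRun (D : TreeFlowDS) (B : ℕ) (ω : ℕ → Bool) (π τ : ℝ) {n : ℕ} (I : TreeFlowInput n)
    (ops : List (TreeFlowOp n)) (outs : List RamState) : Prop :=
  ∃ (t : ℕ) (s : RamState),
    Runs B ω D.prep I.initState t s ∧ (t : ℝ) ≤ π ∧ D.Serves B ω τ s ops outs

/-- The state `s` returns a number that lies between `x / α` and `x * α`. -/
def ReturnsApprox (α : ℝ) (s : RamState) (x : ℚ) : Prop :=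
  ∃ q : ℚ, Returns s q ∧ (q : ℝ) ∈ Set.uIcc ((x : ℝ) / α) ((x : ℝ) * α)

/-- `D` implements the `α`-approximate TreeFlow data structure with words of
`c * (⌊log₂ n⌋ + 1)` bits: on inputs and admissible sequences of at most `n ^ k` operations whose
numbers have numerators and denominators of at most `a * (⌊log₂ n⌋ + 1)` bits, preprocessing always
takes at most `C * n ^ (3 - ε)` steps, every operation always takes at most `C * n ^ (1 - ε)` steps,
and the probability that not all answers are `α`-approximate is at most `1 / 3`. -/
def Implements (D : TreeFlowDS) (a k : ℕ) (α : ℕ → ℝ) (ε : ℝ) (c : ℕ) (C : ℝ) : Prop :=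
  ∀ n : ℕ, 1 ≤ n → ∀ (I : TreeFlowInput n) (ops : List (TreeFlowOp n)),
    I.Fits (wordBound a n) → I.Admissible (wordBound a n) (fun _ => 0) ops →
    ops.length ≤ n ^ k →
    (∀ ω, ∃ outs, D.FullRun (wordBound c n) ω (C * (n : ℝ) ^ (3 - ε)) (C * (n : ℝ) ^ (1 - ε))
      I ops outs) ∧
    coinMeasure {ω | ¬ ∃ outs,
      D.FullRun (wordBound c n) ω (C * (n : ℝ) ^ (3 - ε)) (C * (n : ℝ) ^ (1 - ε)) I ops outs ∧
      List.Forall₂ (ReturnsApprox (α n)) outs (I.answers (fun _ => 0) ops)} ≤ 1 / 3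

end TreeFlowDS

/-! ### Embedding a program into a larger machine -/

/-! A TreeFlow structure can multiply a Boolean matrix with vectors. For an `n × n` matrix `M`, the
spanning tree is a star whose leaves are the rows and the columns. The graph has in addition an edge
between row `i` and column `j` whenever `M i j` is true; resistances are `1` and supplies `0`. A
leaf is its own subtree, so `addvalue` there changes a single value and `findflow` sees the flow out
of a single vertex. Put `v j` on column `j` while rows and root stay at `0`. Then the exact answer
at row `i` is the number of `j` with `M i j` and `v j` both true (`answer_eq`). An approximation
within any factor `α ≥ 1` still tells whether this number is zero (`returnsApprox_iff`), and that is
coordinate `i` of `M v`. Subtracting the values again restores the zero state for the next vector.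

The instance has `2 * n + 1` vertices, and `n` vectors cost `3 * n ^ 2` operations, which `k ≥ 2`
allows. The time bounds of TreeFlow thus give OMv in time `O(n ^ (3 - δ))` with `δ = min ε 1`; the
cap leaves room for the quadratic cost of writing the input and driving the operations
(`total_time_le`). The operations do not depend on earlier answers and only the TreeFlow programs
draw random bits. Hence both algorithms run on the same tape, and an OMv error forces a TreeFlow
error (`solves_alg`).

The rest is programming: the TreeFlow programs run on registers and arrays disjoint from those of
the OMv code (`Runs.shift`), and `halts_prepProg` and `halts_queryProg` verify the code around them.
-/

/-- The first register available to the embedded program. -/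
abbrev regBase : ℕ := 32

/-- The first array available to the embedded program. -/
abbrev arrBase : ℕ := 4

/-- Move all registers of a program up by `regBase` and all its arrays up by `arrBase`. -/
def Cmd.shift : Cmd → Cmd
  | .skip => .skip
  | .const d k => .const (regBase + d) k
  | .op o d i j => .op o (regBase + d) (regBase + i) (regBase + j)
  | .load d a i => .load (regBase + d) (arrBase + a) (regBase + i)
  | .store a i j => .store (arrBase + a) (regBase + i) (regBase + j)
  | .rand d l => .rand (regBase + d) (regBase + l)
  | .seq p q => .seq p.shift q.shift
  | .ite i p q => .ite (regBase + i) p.shift q.shift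
  | .while i p => .while (regBase + i) p.shift

namespace RamState

theorem ext' {s t : RamState} (h₁ : s.reg = t.reg) (h₂ : s.mem = t.mem) (h₃ : s.used = t.used) :
    s = t := by
  cases s; cases t; simp_all

/-- The part of a state that the embedded program sees. -/
def view (s : RamState) : RamState :=
  ⟨fun i => s.reg (regBase + i), fun a => s.mem (arrBase + a), s.used⟩

/-- Two states agree on everything that is hidden from the embedded program. -/
def SameOwn (s t : RamState) : Prop :=
  (∀ i < regBase, s.reg i = t.reg i) ∧ ∀ a < arrBase, s.mem a = t.mem a

theorem SameOwn.rfl {s : RamState} : SameOwn s s := ⟨fun _ _ => Eq.refl _, fun _ _ => Eq.refl _⟩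

theorem SameOwn.trans {s t u : RamState} (h : SameOwn s t) (h' : SameOwn t u) : SameOwn s u :=
  ⟨fun i hi => (h.1 i hi).trans (h'.1 i hi), fun i hi => (h.2 i hi).trans (h'.2 i hi)⟩

@[simp] theorem view_reg (s : RamState) (i : ℕ) : s.view.reg i = s.reg (regBase + i) := rfl

@[simp] theorem view_mem (s : RamState) (a : ℕ) : s.view.mem a = s.mem (arrBase + a) := rfl

/-! ### Effect of register and array writes on the two halves of a state. -/

theorem view_setReg_shift (s : RamState) (d x : ℕ) :
    (s.setReg (regBase + d) x).view = s.view.setReg d x := by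
  refine ext' (funext fun i => ?_) rfl rfl
  simp [setReg, view, Function.update_apply]

theorem view_setReg_own (s : RamState) {d : ℕ} (hd : d < 32) (x : ℕ) :
    (s.setReg d x).view = s.view := by
  refine ext' (funext fun i => ?_) rfl rfl
  simp only [setReg, view, Function.update_apply]
  rw [if_neg (by simp only [regBase]; omega)]

theorem view_setArr_shift (s : RamState) (a : ℕ) (f : ℕ → ℕ) :
    (s.setArr (arrBase + a) f).view = s.view.setArr a f := by
  refine ext' rfl (funext fun i => ?_) rfl
  simp [setArr, view, Function.update_apply]

theorem view_setArr_own (s : RamState) {a : ℕ} (ha : a < 4) (f : ℕ → ℕ) :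
    (s.setArr a f).view = s.view := by
  refine ext' rfl (funext fun i => ?_) rfl
  simp only [setArr, view, Function.update_apply]
  rw [if_neg (by simp only [arrBase]; omega)]

theorem view_setCell_shift (s : RamState) (a p x : ℕ) :
    (s.setCell (arrBase + a) p x).view = s.view.setCell a p x :=
  view_setArr_shift _ _ _

theorem view_setCell_own (s : RamState) {a : ℕ} (ha : a < 4) (p x : ℕ) :
    (s.setCell a p x).view = s.view :=
  view_setArr_own _ ha _

theorem sameOwn_setReg (s : RamState) (d x : ℕ) : SameOwn s (s.setReg (regBase + d) x) := by
  refine ⟨fun i hi => ?_, fun _ _ => Eq.refl _⟩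
  simp only [setReg, Function.update_apply]
  rw [if_neg (by omega)]

theorem sameOwn_setCell (s : RamState) (a p x : ℕ) :
    SameOwn s (s.setCell (arrBase + a) p x) := by
  refine ⟨fun _ _ => Eq.refl _, fun i hi => ?_⟩
  simp only [setCell, setArr, Function.update_apply]
  rw [if_neg (by omega)]

@[simp] theorem setReg_reg (s : RamState) (d x i : ℕ) :
    (s.setReg d x).reg i = if i = d then x else s.reg i := by
  simp [setReg, Function.update_apply]

@[simp] theorem setReg_mem (s : RamState) (d x : ℕ) : (s.setReg d x).mem = s.mem := rfl

@[simp] theorem setArr_reg (s : RamState) (a : ℕ) (f : ℕ → ℕ) : (s.setArr a f).reg = s.reg := rfl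

@[simp] theorem setArr_mem (s : RamState) (a b : ℕ) (f : ℕ → ℕ) :
    (s.setArr a f).mem b = if b = a then f else s.mem b := by
  simp [setArr, Function.update_apply]

@[simp] theorem setCell_reg (s : RamState) (a p x : ℕ) : (s.setCell a p x).reg = s.reg := rfl

@[simp] theorem setCell_mem (s : RamState) (a p x b : ℕ) :
    (s.setCell a p x).mem b = if b = a then Function.update (s.mem a) p x else s.mem b := by
  simp [setCell]

theorem setReg_shift_reg (s : RamState) (d x : ℕ) {i : ℕ} (hi : i < 32) :
    (s.setReg (regBase + d) x).reg i = s.reg i :=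
  ((sameOwn_setReg s d x).1 i hi).symm

end RamState

open RamState in
/-- A run of a program is mirrored by a run of the shifted program in a machine with longer words. -/
theorem Runs.shift {B B' : ℕ} (hB : B ≤ B') {ω : ℕ → Bool} {p : Cmd} {s s' : RamState} {t : ℕ}
    (h : Runs B ω p s t s') (S : RamState) (hS : S.view = s) :
    ∃ S', Runs B' ω p.shift S t S' ∧ S'.view = s' ∧ SameOwn S S' := by
  induction h generalizing S with
  | skip s => exact ⟨S, .skip S, hS, .rfl⟩
  | const s d k h =>
    exact ⟨_, .const S _ k (h.trans_le hB), by rw [view_setReg_shift, hS], sameOwn_setReg _ _ _⟩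
  | op s o d i j h =>
    subst hS
    exact ⟨_, .op S o _ _ _ (h.trans_le hB), view_setReg_shift _ _ _, sameOwn_setReg _ _ _⟩
  | load s d a i h =>
    subst hS
    exact ⟨_, .load S _ _ _ (h.trans_le hB), view_setReg_shift _ _ _, sameOwn_setReg _ _ _⟩
  | store s a i j hi hj =>
    subst hS
    exact ⟨_, .store S _ _ _ (hi.trans_le hB) (hj.trans_le hB), view_setCell_shift _ _ _ _,
      sameOwn_setCell _ _ _ _⟩
  | rand s d l h =>
    subst hS
    -- The view keeps `used`, so both machines read the same bits of the tape. Counting bits touches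
    -- neither registers nor arrays, so `SameOwn` for a register write carries over; its array half
    -- ignores the written value, here `0`.
    refine ⟨_, .rand S _ _ (h.trans hB), ?_, (sameOwn_setReg S d _).1, (sameOwn_setReg S d 0).2⟩
    exact congrArg (fun u => useBits u _) (view_setReg_shift S d _)
  | seq p q s s' s'' t t' h h' ih ih' =>
    obtain ⟨S₁, r₁, v₁, o₁⟩ := ih S hS
    obtain ⟨S₂, r₂, v₂, o₂⟩ := ih' S₁ v₁
    exact ⟨S₂, .seq _ _ _ _ _ _ _ r₁ r₂, v₂, o₁.trans o₂⟩
  | iteTrue i p q s s' t hi h ih =>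
    obtain ⟨S₁, r₁, v₁, o₁⟩ := ih S hS
    subst hS
    exact ⟨S₁, .iteTrue _ _ _ _ _ _ hi r₁, v₁, o₁⟩
  | iteFalse i p q s s' t hi h ih =>
    obtain ⟨S₁, r₁, v₁, o₁⟩ := ih S hS
    subst hS
    exact ⟨S₁, .iteFalse _ _ _ _ _ _ hi r₁, v₁, o₁⟩
  | whileDone i p s hi =>
    subst hS
    exact ⟨S, .whileDone _ _ _ hi, rfl, .rfl⟩
  | whileStep i p s s' s'' t t' hi h h' ih ih' =>
    obtain ⟨S₁, r₁, v₁, o₁⟩ := ih S hS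
    obtain ⟨S₂, r₂, v₂, o₂⟩ := ih' S₁ v₁
    subst hS
    exact ⟨S₂, .whileStep _ _ _ _ _ _ _ hi r₁ r₂, v₂, o₁.trans o₂⟩

/-! ### Total correctness with time bounds -/

/-- Started in `s`, the program `p` halts within `T` steps in a state that satisfies `Q`. -/
def Halts (B : ℕ) (ω : ℕ → Bool) (p : Cmd) (s : RamState) (T : ℕ) (Q : RamState → Prop) : Prop :=
  ∃ t s', Runs B ω p s t s' ∧ t ≤ T ∧ Q s'

namespace Halts

variable {B : ℕ} {ω : ℕ → Bool} {p q : Cmd} {s : RamState} {T T' : ℕ} {P Q : RamState → Prop}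

theorem mono (h : Halts B ω p s T P) (hT : T ≤ T') (hPQ : ∀ s', P s' → Q s') :
    Halts B ω p s T' Q := by
  obtain ⟨t, s', r, ht, hP⟩ := h
  exact ⟨t, s', r, ht.trans hT, hPQ _ hP⟩

theorem seq (h : Halts B ω p s T fun s' => Halts B ω q s' T' Q) :
    Halts B ω (.seq p q) s (T + T') Q := by
  obtain ⟨t, s', r, ht, t', s'', r', ht', hQ⟩ := h
  exact ⟨_, _, .seq _ _ _ _ _ _ _ r r', add_le_add ht ht', hQ⟩

theorem skip (h : Q s) : Halts B ω .skip s 1 Q := ⟨1, s, .skip s, le_rfl, h⟩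

theorem const {d k : ℕ} (hk : k < B) (h : Q (s.setReg d k)) : Halts B ω (.const d k) s 1 Q :=
  ⟨1, _, .const s d k hk, le_rfl, h⟩

theorem op {o : WordOp} {d i j : ℕ} (x : ℕ) (hx : o.eval (s.reg i) (s.reg j) = x) (hB : x < B)
    (h : Q (s.setReg d x)) : Halts B ω (.op o d i j) s 1 Q := by
  subst hx
  exact ⟨1, _, .op s o d i j hB, le_rfl, h⟩

theorem load {d a i : ℕ} (x : ℕ) (hx : s.mem a (s.reg i) = x) (hB : x < B)
    (h : Q (s.setReg d x)) : Halts B ω (.load d a i) s 1 Q := by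
  subst hx
  exact ⟨1, _, .load s d a i hB, le_rfl, h⟩

theorem store {a i j : ℕ} (x y : ℕ) (hx : s.reg i = x) (hy : s.reg j = y) (hxB : x < B)
    (hyB : y < B) (h : Q (s.setCell a x y)) : Halts B ω (.store a i j) s 1 Q := by
  subst hx hy
  exact ⟨1, _, .store s a i j hxB hyB, le_rfl, h⟩

theorem shift {B₀ t : ℕ} (hB : B₀ ≤ B) {s₀ s₁ : RamState} (r : Runs B₀ ω p s₀ t s₁) (ht : t ≤ T)
    (hs : s.view = s₀) (h : ∀ s', s'.view = s₁ → s.SameOwn s' → Q s') :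
    Halts B ω p.shift s T Q := by
  obtain ⟨s', r', v, o⟩ := r.shift hB s hs
  exact ⟨t, s', r', ht, h s' v o⟩

end Halts

/-- A sequence of commands. -/
def Cmd.block : List Cmd → Cmd
  | [] => .skip
  | p :: ps => .seq p (block ps)

/-- Count register `i` from `0` up to the content of register `b`; register `1` has to hold `1`, and
register `2` is used for the tests. -/
def Cmd.forLoop (i b : ℕ) (p : Cmd) : Cmd :=
  .block [.const i 0, .op .lt 2 i b,
    .while 2 (.block [p, .op .add i i 1, .op .lt 2 i b])]

theorem Halts.nil {B : ℕ} {ω : ℕ → Bool} {s : RamState} {Q : RamState → Prop} (h : Q s) :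
    Halts B ω (.block []) s 1 Q := Halts.skip h

theorem Halts.cons {B : ℕ} {ω : ℕ → Bool} {p : Cmd} {ps : List Cmd} {s : RamState} {T T' : ℕ}
    {Q : RamState → Prop} (h : Halts B ω p s T fun s' => Halts B ω (.block ps) s' T' Q) :
    Halts B ω (.block (p :: ps)) s (T + T') Q := Halts.seq h

/-- Invariant rule for counting loops. The invariant must survive writes to the test register `2`,
and the body has to establish it for the state that the increment is about to produce. A round costs
four steps beyond the body: increment, comparison, the `skip` ending the block, and the test of
`while`. The final `4` pays for initialisation, first comparison, last test and last `skip`. -/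
theorem Halts.forLoop {B : ℕ} {ω : ℕ → Bool} {i b m T : ℕ} {p : Cmd} {s : RamState}
    {Q : RamState → Prop} (Inv : ℕ → RamState → Prop) (hm : m < B) (h1 : 1 < B)
    (hreg : ∀ k s, Inv k s → s.reg b = m ∧ s.reg 1 = 1 ∧ s.reg i = k)
    (hinit : Inv 0 (s.setReg i 0))
    (htest : ∀ k s x, Inv k s → Inv k (s.setReg 2 x))
    (hbody : ∀ k s, k < m → Inv k s →
      Halts B ω p s T fun s' => s'.reg i = k ∧ s'.reg 1 = 1 ∧ Inv (k + 1) (s'.setReg i (k + 1)))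
    (hQ : ∀ s, Inv m s → Q s) :
    Halts B ω (.forLoop i b p) s (m * (T + 4) + 4) Q := by
  -- Induction on the number `j` of remaining rounds; register `2` already holds the outcome of the
  -- next test.
  have key : ∀ j k s, k + j = m → Inv k s → s.reg 2 = (if k < m then 1 else 0) →
      Halts B ω (.while 2 (.block [p, .op .add i i 1, .op .lt 2 i b])) s (j * (T + 4) + 1) Q := by
    intro j
    induction j with
    | zero =>
      intro k s hk hI h2
      obtain rfl : k = m := by omega
      exact ⟨1, s, .whileDone _ _ _ (by simpa using h2), by omega, hQ _ hI⟩
    | succ j ih =>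
      intro k s hk hI h2
      have hkm : k < m := by omega
      obtain ⟨t, s₁, r, ht, hri, hr1, hI₁⟩ := hbody k s hkm hI
      have hreg₁ := hreg _ _ hI₁
      obtain ⟨t₂, s₂, r₂, ht₂, hQ₂⟩ := ih (k + 1)
        ((s₁.setReg i (k + 1)).setReg 2 (if k + 1 < m then 1 else 0)) (by omega)
        (htest _ _ _ hI₁) (by simp)
      refine ⟨(t + (1 + (1 + 1))) + t₂ + 1, s₂, .whileStep _ _ _ _ _ _ _ (by simp [h2, hkm])
        (.seq _ _ _ _ _ _ _ r (.seq _ _ _ (s₁.setReg i (k + 1)) _ _ _ ?_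
          (.seq _ _ _ _ _ _ _ ?_ (.skip _)))) r₂, ?_, hQ₂⟩
      · have := Runs.op (B := B) (ω := ω) s₁ .add i i 1
          (by simp only [WordOp.eval, hri, hr1]; omega)
        simpa only [WordOp.eval, hri, hr1] using this
      · have hev : WordOp.lt.eval ((s₁.setReg i (k + 1)).reg i) ((s₁.setReg i (k + 1)).reg b) =
            if k + 1 < m then 1 else 0 := by
          rw [hreg₁.1, hreg₁.2.2, WordOp.eval]
        have := Runs.op (B := B) (ω := ω) (s₁.setReg i (k + 1)) .lt 2 i b
          (by rw [hev]; split_ifs <;> omega)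
        rwa [hev] at this
      · rw [add_mul]; omega
  have hreg₀ := hreg _ _ hinit
  have hT : m * (T + 4) + 4 = 1 + (1 + ((m * (T + 4) + 1) + 1)) := by omega
  rw [hT]
  refine .cons (.const (by omega) (.cons (.op (if 0 < m then 1 else 0) ?_ ?_ (.cons ?_))))
  · rw [hreg₀.1, hreg₀.2.2, WordOp.eval]
  · split_ifs <;> omega
  · exact (key m 0 _ (by omega) (htest _ _ _ hinit) (by simp)).mono le_rfl fun s hs => .nil hs

/-! ### Symbolic execution of straight-line code. -/

namespace Halts

variable {B : ℕ} {ω : ℕ → Bool} {ps : List Cmd} {s : RamState} {T : ℕ} {Q : RamState → Prop}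

theorem const_cons {d k : ℕ} (hk : k < B) (h : Halts B ω (.block ps) (s.setReg d k) T Q) :
    Halts B ω (.block (.const d k :: ps)) s (T + 1) Q :=
  (cons (const hk h)).mono (by omega) fun _ h => h

/-- The caller names the result `x` and checks it against the operation, so a straight-line program
is verified by listing its intermediate values. -/
theorem op_cons {o : WordOp} {d i j : ℕ} (x : ℕ) (hx : o.eval (s.reg i) (s.reg j) = x)
    (hB : x < B) (h : Halts B ω (.block ps) (s.setReg d x) T Q) :
    Halts B ω (.block (.op o d i j :: ps)) s (T + 1) Q :=
  (cons (op x hx hB h)).mono (by omega) fun _ h => h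

theorem load_cons {d a i : ℕ} (x : ℕ) (hx : s.mem a (s.reg i) = x) (hB : x < B)
    (h : Halts B ω (.block ps) (s.setReg d x) T Q) :
    Halts B ω (.block (.load d a i :: ps)) s (T + 1) Q :=
  (cons (load x hx hB h)).mono (by omega) fun _ h => h

theorem store_cons {a i j : ℕ} (x y : ℕ) (hx : s.reg i = x) (hy : s.reg j = y) (hxB : x < B)
    (hyB : y < B) (h : Halts B ω (.block ps) (s.setCell a x y) T Q) :
    Halts B ω (.block (.store a i j :: ps)) s (T + 1) Q :=
  (cons (store x y hx hy hxB hyB h)).mono (by omega) fun _ h => h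

end Halts

/-! ### The TreeFlow instance that encodes a Boolean matrix -/

theorem vecArr_apply {n : ℕ} (f : Fin n → ℕ) {p : ℕ} (h : p < n) : vecArr f p = f ⟨p, h⟩ := by
  simp [vecArr, h]

theorem vecArr_of_le {n : ℕ} (f : Fin n → ℕ) {p : ℕ} (h : n ≤ p) : vecArr f p = 0 := by
  simp [vecArr, h]

theorem matArr_apply {n : ℕ} (m : Fin n → Fin n → ℕ) (i j : Fin n) :
    matArr m (i * n + j) = m i j := by
  have hp : (i : ℕ) * n + j < n * n := by nlinarith [i.2, j.2]
  rw [matArr, vecArr_apply _ hp]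
  congr 1
  · ext
    change ((i : ℕ) * n + j) / n = i
    rw [mul_comm, Nat.mul_add_div (Nat.pos_of_ne_zero fun h => by have := i.2; omega),
      Nat.div_eq_of_lt j.2, add_zero]
  · ext
    change ((i : ℕ) * n + j) % n = j
    rw [mul_comm, Nat.mul_add_mod, Nat.mod_eq_of_lt j.2]

theorem matArr_of_le {n : ℕ} (m : Fin n → Fin n → ℕ) {p : ℕ} (h : n * n ≤ p) : matArr m p = 0 :=
  vecArr_of_le _ h

namespace OMvReduction

variable {n : ℕ}

/-- The cells of the array that holds the matrix. -/
def cells (M : Fin n → Fin n → Bool) : ℕ → ℕ := matArr fun i j => (M i j).toNat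

/-- The cells of the array that holds the vector. -/
def coord (v : Fin n → Bool) : ℕ → ℕ := vecArr fun j => (v j).toNat

theorem cells_le_one (M : Fin n → Fin n → Bool) (p : ℕ) : cells M p ≤ 1 := by
  unfold cells matArr vecArr
  split_ifs
  · exact Bool.toNat_le _
  · exact Nat.zero_le 1

theorem coord_le_one (v : Fin n → Bool) (p : ℕ) : coord v p ≤ 1 := by
  unfold coord vecArr
  split_ifs
  · exact Bool.toNat_le _
  · exact Nat.zero_le 1

/-- The root, vertex `2 * n`. -/
def center (n : ℕ) : Fin (2 * n + 1) := ⟨2 * n, by omega⟩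

/-- The vertex of row `i`. -/
def rowVert (i : Fin n) : Fin (2 * n + 1) := ⟨i, by omega⟩

/-- The vertex of column `j`. -/
def colVert (j : Fin n) : Fin (2 * n + 1) := ⟨n + j, by omega⟩

theorem rowVert_ne_center (i : Fin n) : rowVert i ≠ center n := by
  simp only [rowVert, center, ne_eq, Fin.mk.injEq]; omega

theorem colVert_ne_center (j : Fin n) : colVert j ≠ center n := by
  simp only [colVert, center, ne_eq, Fin.mk.injEq]; omega

/-- The star with an edge between row `i` and column `j` for every entry `1` of the matrix. -/
def graph (M : Fin n → Fin n → Bool) : SimpleGraph (Fin (2 * n + 1)) :=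
  .fromRel fun u v => u = center n ∨ (n ≤ (v : ℕ) ∧ cells M (u * n + (v - n)) ≠ 0)

/-- The relation needs no test that `u` is a row: for `u ≥ n` the index is at least `n * n`, where
`cells` vanishes. If `v` is the center the index may run into the next row, which is harmless
because the center is adjacent to all other vertices anyway. -/
theorem graph_adj (M : Fin n → Fin n → Bool) (u v : Fin (2 * n + 1)) :
    (graph M).Adj u v ↔ u ≠ v ∧
      ((u = center n ∨ (n ≤ (v : ℕ) ∧ cells M (u * n + (v - n)) ≠ 0)) ∨
        (v = center n ∨ (n ≤ (u : ℕ) ∧ cells M (v * n + (u - n)) ≠ 0))) := by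
  simp [graph]

theorem cells_apply (M : Fin n → Fin n → Bool) (i j : Fin n) :
    cells M (i * n + j) = (M i j).toNat := matArr_apply _ i j

theorem graph_adj_row_col (M : Fin n → Fin n → Bool) (i j : Fin n) :
    (graph M).Adj (rowVert i) (colVert j) ↔ M i j = true := by
  have h : ¬ n ≤ (i : ℕ) := by omega
  have h' : ¬ (i : ℕ) = n + j := by omega
  simp [graph_adj, rowVert_ne_center, colVert_ne_center]
  simp [rowVert, colVert, h, h', cells_apply]

/-- The TreeFlow input for a Boolean matrix. -/
def input (M : Fin n → Fin n → Bool) : TreeFlowInput (2 * n + 1) where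
  G := graph M
  T := .starGraph (center n)
  root := center n
  r _ := 1
  b _ := 0
  le u v h := by
    rw [SimpleGraph.starGraph_adj] at h
    rw [graph_adj]
    tauto
  isTree := SimpleGraph.isTree_starGraph _
  r_pos _ _ := one_pos
  b_sum := by simp

/-- The only path from a leaf `u` to the center is a single edge, whose support is `u` and the
center; the path from the center to itself is trivial. So no vertex other than `v` has the leaf `v`
on its path. -/
theorem subtree_eq (M : Fin n → Fin n → Bool) {v : Fin (2 * n + 1)} (hv : v ≠ center n) :
    (input M).subtree v = {v} := by
  ext u
  simp only [TreeFlowInput.subtree, Set.mem_ofPred_eq, Set.mem_singleton_iff]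
  constructor
  · rintro ⟨p, hp, hmem⟩
    by_cases hu : u = center n
    · obtain rfl : u = (input M).root := hu
      rw [(SimpleGraph.Walk.isPath_iff_nil.1 hp).eq_nil, SimpleGraph.Walk.support_nil,
        List.mem_singleton] at hmem
      exact absurd hmem hv
    · have hadj : (input M).T.Adj u (input M).root := by
        simp [input, hu]
      have hq : hadj.toWalk.IsPath := by
        simp [hadj.ne]
      have := ((input M).isTree.existsUnique_path u (input M).root).unique hp hq
      subst this
      simp at hmem
      rcases hmem with rfl | h
      · rfl
      · exact absurd h hv
  · rintro rfl
    obtain ⟨p, hp, -⟩ := (input M).isTree.existsUnique_path u (input M).root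
    exact ⟨p, hp, p.start_mem_support⟩

theorem bump_eq (M : Fin n → Fin n → Bool) (val : Fin (2 * n + 1) → ℚ) {v : Fin (2 * n + 1)}
    (hv : v ≠ center n) (x : ℚ) (u : Fin (2 * n + 1)) :
    (input M).bump val v x u = if u = v then val u + x else val u := by
  simp [TreeFlowInput.bump, subtree_eq M hv]

/-- The vertex values when the coordinates of the vector with numbers from `lo` to `hi - 1` are
stored at their columns. -/
def colVal (v : Fin n → Bool) (lo hi : ℕ) (u : Fin (2 * n + 1)) : ℚ :=
  if n + lo ≤ (u : ℕ) ∧ (u : ℕ) < n + hi then (coord v (u - n) : ℚ) else 0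

theorem colVal_self (v : Fin n → Bool) (k : ℕ) : colVal v k k = fun _ => 0 := by
  funext u
  rw [colVal, if_neg (by omega)]

theorem colVal_eq (v : Fin n → Bool) (lo hi : ℕ) (u : Fin (2 * n + 1)) :
    colVal v lo hi u = 0 ∨ colVal v lo hi u = 1 := by
  unfold colVal
  split_ifs
  · have := coord_le_one v (u - n)
    interval_cases coord v (u - n) <;> simp
  · simp

theorem coord_apply (v : Fin n → Bool) (j : Fin n) : coord v j = (v j).toNat := vecArr_apply _ j.2

theorem bump_add (M : Fin n → Fin n → Bool) (v : Fin n → Bool) (j : Fin n) :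
    (input M).bump (colVal v 0 j) (colVert j) (coord v j) = colVal v 0 (j + 1) := by
  funext u
  rw [bump_eq M _ (colVert_ne_center j)]
  simp only [colVal, colVert, Fin.ext_iff]
  split_ifs with h₁ h₂ h₃ h₄ h₅ <;> first | omega | simp_all

/-- Removal shrinks the interval of stored coordinates from below, so it ends with the empty
interval from `n` to `n`, the zero valuation. -/
theorem bump_sub (M : Fin n → Fin n → Bool) (v : Fin n → Bool) (j : Fin n) :
    (input M).bump (colVal v j n) (colVert j) (-(coord v j : ℚ)) = colVal v (j + 1) n := by
  funext u
  rw [bump_eq M _ (colVert_ne_center j)]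
  have := j.2
  simp only [colVal, colVert, Fin.ext_iff]
  split_ifs with h₁ h₂ h₃ h₄ h₅ <;> first | omega | simp_all

/-- The number of columns in which both row `i` of the matrix and the vector have a `1`. -/
def count (M : Fin n → Fin n → Bool) (v : Fin n → Bool) (i : Fin n) : ℕ :=
  (Finset.univ.filter fun j => M i j = true ∧ v j = true).card

theorem count_le (M : Fin n → Fin n → Bool) (v : Fin n → Bool) (i : Fin n) : count M v i ≤ n :=
  (Finset.card_le_univ _).trans (by simp)

theorem count_pos_iff (M : Fin n → Fin n → Bool) (v : Fin n → Bool) (i : Fin n) :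
    0 < count M v i ↔ boolMulVec M v i = true := by
  simp [count, Finset.card_pos, boolMulVec, Finset.Nonempty]

/-- The edges leaving the single vertex of row `i` go to the center, of value `0`, and to the
columns with a `1` in that row. As the row itself has value `0`, each edge carries minus the value
at its other end, and the supply is `0`. -/
theorem answer_eq (M : Fin n → Fin n → Bool) (v : Fin n → Bool) (i : Fin n) :
    (input M).answer (colVal v 0 n) (rowVert i) = count M v i := by
  classical
  have hrow : colVal v 0 n (rowVert i) = 0 := by
    rw [colVal, if_neg]
    simp only [rowVert]; omega
  have hinj : Function.Injective (colVert (n := n)) := by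
    intro j j' h
    simp only [colVert, Fin.mk.injEq] at h
    ext; omega
  have hflow : (input M).flow (colVal v 0 n) {rowVert i} =
      ∑ w, if (graph M).Adj (rowVert i) w then -colVal v 0 n w else 0 := by
    unfold TreeFlowInput.flow
    rw [Finset.sum_eq_single (rowVert i)]
    · refine Finset.sum_congr rfl fun w _ => ?_
      by_cases h : (graph M).Adj (rowVert i) w
      · have : w ≠ rowVert i := h.ne'
        simp [input, h, this, hrow]
      · simp [input, h]
    · intro u _ hu
      simp [hu]
    · simp
  -- Only columns have nonzero values, so the sum over all vertices can be pulled back along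
  -- `colVert`.
  have hsum : (∑ w, if (graph M).Adj (rowVert i) w then -colVal v 0 n w else 0) =
      ∑ j : Fin n, if M i j = true ∧ v j = true then (-1 : ℚ) else 0 := by
    symm
    refine Finset.sum_of_injOn colVert hinj.injOn (fun _ _ => Finset.mem_univ _) ?_ ?_
    · intro w _ hw
      have : colVal v 0 n w = 0 := by
        rw [colVal, if_neg]
        rintro ⟨h₁, h₂⟩
        refine hw ⟨⟨w - n, by omega⟩, Finset.mem_coe.2 (Finset.mem_univ _), ?_⟩
        simp only [colVert, Fin.ext_iff]; omega
      simp [this]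
    · intro j _
      have hv : colVal v 0 n (colVert j) = (v j).toNat := by
        rw [colVal, if_pos (by simp only [colVert]; omega)]
        simp [colVert, coord_apply]
      rw [hv]
      simp only [graph_adj_row_col]
      cases M i j <;> cases v j <;> simp
  rw [TreeFlowInput.answer, subtree_eq M (rowVert_ne_center i), hflow, hsum, count,
    Finset.card_filter]
  simp [TreeFlowInput.supply, input, Finset.sum_ite]

/-! ### The operations for one vector -/

/-- The list of the operations `f k, …, f (n - 1)`. -/
def opsFrom (f : Fin n → TreeFlowOp (2 * n + 1)) (k : ℕ) : List (TreeFlowOp (2 * n + 1)) :=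
  ((List.finRange n).drop k).map f

theorem opsFrom_lt (f : Fin n → TreeFlowOp (2 * n + 1)) (j : Fin n) :
    opsFrom f j = f j :: opsFrom f (j + 1) := by
  rw [opsFrom, List.drop_eq_getElem_cons (by simp)]
  simp [opsFrom]

theorem opsFrom_self (f : Fin n → TreeFlowOp (2 * n + 1)) : opsFrom f n = [] := by
  simp [opsFrom]

theorem opsFrom_length (f : Fin n → TreeFlowOp (2 * n + 1)) : (opsFrom f 0).length = n := by
  simp [opsFrom]

/-- Induction from `n` down to `0`. -/
theorem downInduction {P : ℕ → Prop} (hn : P n) (h : ∀ j : Fin n, P (j + 1) → P j) : P 0 :=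
  Nat.decreasingInduction (motive := fun k _ => P k) (fun k hk => h ⟨k, hk⟩) hn (Nat.zero_le n)

/-- Store the coordinate `j` of a vector at its column. -/
def addOp (v : Fin n → Bool) (j : Fin n) : TreeFlowOp (2 * n + 1) := .addvalue (colVert j) (coord v j)

/-- Query the row `i`. -/
def findOp (i : Fin n) : TreeFlowOp (2 * n + 1) := .findflow (rowVert i)

/-- Remove the coordinate `j` of a vector from its column. -/
def subOp (v : Fin n → Bool) (j : Fin n) : TreeFlowOp (2 * n + 1) :=
  .addvalue (colVert j) (-(coord v j : ℚ))

/-- The operations that process one vector, followed by `ops`. -/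
def roundOps (v : Fin n → Bool) (ops : List (TreeFlowOp (2 * n + 1))) :
    List (TreeFlowOp (2 * n + 1)) :=
  opsFrom (addOp v) 0 ++ (opsFrom findOp 0 ++ (opsFrom (subOp v) 0 ++ ops))

/-- The operations that process a sequence of vectors. -/
def allOps : List (Fin n → Bool) → List (TreeFlowOp (2 * n + 1))
  | [] => []
  | v :: vs => roundOps v (allOps vs)

theorem allOps_length (vs : List (Fin n → Bool)) : (allOps vs).length = vs.length * (3 * n) := by
  induction vs with
  | nil => simp [allOps]
  | cons v vs ih =>
    simp only [allOps, roundOps, List.length_append, opsFrom_length, ih, List.length_cons]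
    ring

/-- A round starts and ends with all values `0`, so its answers separate from those of later rounds.
Within a phase, `opsFrom f k` begins with operation `k`, which calls for induction from `n`
downwards. -/
theorem answers_roundOps (M : Fin n → Fin n → Bool) (v : Fin n → Bool)
    (ops : List (TreeFlowOp (2 * n + 1))) :
    (input M).answers (fun _ => 0) (roundOps v ops) =
      (List.finRange n).map (fun i => (count M v i : ℚ)) ++ (input M).answers (fun _ => 0) ops := by
  have hadd : ∀ rest, (input M).answers (colVal v 0 0) (opsFrom (addOp v) 0 ++ rest) =
      (input M).answers (colVal v 0 n) rest := fun rest =>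
    downInduction (n := n) (P := fun k => (input M).answers (colVal v 0 k)
      (opsFrom (addOp v) k ++ rest) = (input M).answers (colVal v 0 n) rest)
      (by simp [opsFrom_self]) fun j h => by
        rw [opsFrom_lt, List.cons_append, addOp, TreeFlowInput.answers, bump_add, h]
  have hfind : ∀ rest, (input M).answers (colVal v 0 n) (opsFrom findOp 0 ++ rest) =
      ((List.finRange n).drop 0).map (fun i => (count M v i : ℚ)) ++
        (input M).answers (colVal v 0 n) rest := fun rest =>
    downInduction (n := n) (P := fun k => (input M).answers (colVal v 0 n)
      (opsFrom findOp k ++ rest) = ((List.finRange n).drop k).map (fun i => (count M v i : ℚ)) ++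
        (input M).answers (colVal v 0 n) rest)
      (by simp [opsFrom_self]) fun j h => by
        rw [opsFrom_lt, List.cons_append, findOp, TreeFlowInput.answers, h, answer_eq,
          List.drop_eq_getElem_cons (i := j) (by simp)]
        simp
  have hsub : ∀ rest, (input M).answers (colVal v 0 n) (opsFrom (subOp v) 0 ++ rest) =
      (input M).answers (colVal v n n) rest := fun rest =>
    downInduction (n := n) (P := fun k => (input M).answers (colVal v k n)
      (opsFrom (subOp v) k ++ rest) = (input M).answers (colVal v n n) rest)
      (by simp [opsFrom_self]) fun j h => by
        rw [opsFrom_lt, List.cons_append, subOp, TreeFlowInput.answers, bump_sub, h]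
  rw [← colVal_self v 0, roundOps, hadd, hfind, hsub, colVal_self, colVal_self]
  simp

/-! ### Admissibility of the instance and of its operations. -/

theorem fitsIn_zero {B : ℕ} (hB : 2 ≤ B) : FitsIn B 0 := by
  simp only [FitsIn, Rat.num_ofNat, Rat.den_ofNat]; omega

theorem fitsIn_one {B : ℕ} (hB : 2 ≤ B) : FitsIn B 1 := by
  simp only [FitsIn, Rat.num_ofNat, Rat.den_ofNat]; omega

theorem fitsIn_nat {B m : ℕ} (hB : 2 ≤ B) (hm : m < B) : FitsIn B (m : ℚ) := by
  simp only [FitsIn, Rat.num_natCast, Rat.den_natCast, Int.natAbs_natCast]; omega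

theorem fitsIn_neg {B : ℕ} {q : ℚ} (h : FitsIn B q) : FitsIn B (-q) := by
  simpa [FitsIn] using h

theorem colVal_ok {B : ℕ} (hB : 2 ≤ B) (v : Fin n → Bool) (lo hi : ℕ) (u : Fin (2 * n + 1)) :
    0 ≤ colVal v lo hi u ∧ FitsIn B (colVal v lo hi u) := by
  rcases colVal_eq v lo hi u with h | h <;> rw [h]
  · exact ⟨le_rfl, fitsIn_zero hB⟩
  · exact ⟨zero_le_one, fitsIn_one hB⟩

/-- Vertex values are `0` or `1`, arguments are `0` or `±1`, and answers are counts of at most `n`;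
hence `n < B` suffices. The three nested inductions are the three phases of the round. -/
theorem admissible_roundOps {B : ℕ} (hB : 2 ≤ B) (hn : n < B) (M : Fin n → Fin n → Bool)
    (v : Fin n → Bool) (ops : List (TreeFlowOp (2 * n + 1)))
    (h : (input M).Admissible B (fun _ => 0) ops) :
    (input M).Admissible B (fun _ => 0) (roundOps v ops) := by
  have hc : ∀ j, FitsIn B (coord v j : ℚ) := fun j =>
    fitsIn_nat hB ((coord_le_one v j).trans_lt hB)
  rw [← colVal_self v n] at h
  rw [← colVal_self v 0, roundOps]
  refine downInduction (n := n) (P := fun k => (input M).Admissible B (colVal v 0 k)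
    (opsFrom (addOp v) k ++ _)) ?_ fun j h => ?_
  · rw [opsFrom_self, List.nil_append]
    refine downInduction (n := n) (P := fun k => (input M).Admissible B (colVal v 0 n)
      (opsFrom findOp k ++ _)) ?_ fun j h => ?_
    · rw [opsFrom_self, List.nil_append]
      refine downInduction (n := n) (P := fun k => (input M).Admissible B (colVal v k n)
        (opsFrom (subOp v) k ++ _)) ?_ fun j h => ?_
      · rwa [opsFrom_self, List.nil_append]
      · rw [opsFrom_lt, List.cons_append, subOp, TreeFlowInput.Admissible, bump_sub]
        exact ⟨fitsIn_neg (hc _), colVal_ok hB v _ _, h⟩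
    · rw [opsFrom_lt, List.cons_append, findOp, TreeFlowInput.Admissible, answer_eq]
      exact ⟨fitsIn_nat hB ((count_le M v j).trans_lt hn), h⟩
  · rw [opsFrom_lt, List.cons_append, addOp, TreeFlowInput.Admissible, bump_add]
    exact ⟨hc _, colVal_ok hB v _ _, h⟩

theorem admissible_allOps {B : ℕ} (hB : 2 ≤ B) (hn : n < B) (M : Fin n → Fin n → Bool)
    (vs : List (Fin n → Bool)) : (input M).Admissible B (fun _ => 0) (allOps vs) := by
  induction vs with
  | nil => trivial
  | cons v vs ih => exact admissible_roundOps hB hn M v _ ih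

theorem fits_input {B : ℕ} (hB : 2 ≤ B) (M : Fin n → Fin n → Bool) : (input M).Fits B :=
  ⟨fun _ _ => fitsIn_one hB, fun _ => fitsIn_zero hB⟩

/-- A returned number is zero exactly if the exact answer is. -/
theorem returnsApprox_iff {α : ℝ} (hα : 1 ≤ α) {s : RamState} {m : ℕ}
    (h : TreeFlowDS.ReturnsApprox α s (m : ℚ)) : 0 < s.reg 2 ↔ 0 < m := by
  obtain ⟨q, ⟨h3, hq⟩, hmem⟩ := h
  have hm : (0 : ℝ) ≤ m := m.cast_nonneg
  -- For `m ≥ 0` the endpoints are in the usual order. The interval is the point `0` if `m = 0` and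
  -- has a positive lower end otherwise.
  have hle : ((m : ℚ) : ℝ) / α ≤ ((m : ℚ) : ℝ) * α := by
    rw [Rat.cast_natCast, div_le_iff₀ (by linarith)]
    nlinarith [mul_le_mul hα hα zero_le_one (by linarith), mul_nonneg hm (by linarith : 0 ≤ α)]
  rw [Set.uIcc_of_le hle, Rat.cast_natCast] at hmem
  rcases Nat.eq_zero_or_pos m with rfl | hpos
  · have hq0 : q = 0 := by
      have h1 : (q : ℝ) = 0 := le_antisymm (by simpa using hmem.2) (by simpa using hmem.1)
      exact_mod_cast h1
    have : s.reg 2 = 0 := by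
      rw [hq] at hq0
      rcases mul_eq_zero.1 hq0 with h | h
      · split_ifs at h <;> norm_num at h
      · simpa [h3] using h
    omega
  · have hq0 : q ≠ 0 := by
      rintro rfl
      have : (0 : ℝ) < m / α := div_pos (by exact_mod_cast hpos) (by linarith)
      have h1 := hmem.1
      simp only [Rat.cast_zero] at h1
      linarith
    have : s.reg 2 ≠ 0 := by
      intro h0
      exact hq0 (by rw [hq, h0]; simp)
    omega

end OMvReduction

/-! ### The preprocessing program -/

namespace OMvReduction

open RamState

variable {n : ℕ}

/-- The array that agrees with `f` up to cell `k - 1` and is `0` from cell `k` on. -/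
def upTo (k : ℕ) (f : ℕ → ℕ) : ℕ → ℕ := fun q => if q < k then f q else 0

theorem upTo_zero (f : ℕ → ℕ) : upTo 0 f = fun _ => 0 := by
  funext q; simp [upTo]

theorem update_upTo (k : ℕ) (f : ℕ → ℕ) : Function.update (upTo k f) k (f k) = upTo (k + 1) f := by
  funext q
  rw [Function.update_apply, upTo, upTo]
  split_ifs <;> first | rfl | omega | simp_all

/-- Entry `(u, v)` of the adjacency matrix of the star. -/
def starBit (n u v : ℕ) : ℕ :=
  if (if u = 2 * n then 1 else 0) = (if v = 2 * n then 1 else 0) then 0 else 1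

/-- The contribution of the matrix to the edges between `u` and `v`, where `u` is a row. -/
def sideBit (M : Fin n → Fin n → Bool) (u v : ℕ) : ℕ :=
  cells M (u * n + (v - n)) * (if n ≤ v then 1 else 0)

/-- Entry `(u, v)` of the adjacency matrix of the graph. -/
def graphBit (M : Fin n → Fin n → Bool) (u v : ℕ) : ℕ :=
  if 0 < starBit n u v + sideBit M u v + sideBit M v u then 1 else 0

theorem starBit_le (n u v : ℕ) : starBit n u v ≤ 1 := by
  unfold starBit; split_ifs <;> omega

theorem sideBit_le (M : Fin n → Fin n → Bool) (u v : ℕ) : sideBit M u v ≤ 1 := by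
  unfold sideBit
  have := cells_le_one M (u * n + (v - n))
  split_ifs <;> omega

theorem graphBit_le (M : Fin n → Fin n → Bool) (u v : ℕ) : graphBit M u v ≤ 1 := by
  unfold graphBit; split_ifs <;> omega

/-- Two vertices are adjacent in the star when exactly one of them is the center. The decidability
instance is arbitrary because `initState` uses the classical one. -/
theorem starBit_eq (u v : Fin (2 * n + 1)) (_ : Decidable ((SimpleGraph.starGraph (center n)).Adj u v)) :
    starBit n u v = if (SimpleGraph.starGraph (center n)).Adj u v then 1 else 0 := by
  simp only [starBit, SimpleGraph.starGraph_adj, center, Fin.ext_iff, ne_eq]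
  split_ifs <;> first | rfl | omega

theorem sideBit_pos (M : Fin n → Fin n → Bool) (u v : ℕ) :
    0 < sideBit M u v ↔ n ≤ v ∧ cells M (u * n + (v - n)) ≠ 0 := by
  unfold sideBit
  split_ifs with h
  · simp; omega
  · simp; omega

theorem cells_of_le (M : Fin n → Fin n → Bool) {p : ℕ} (h : n * n ≤ p) : cells M p = 0 :=
  matArr_of_le _ h

theorem graphBit_eq (M : Fin n → Fin n → Bool) (u v : Fin (2 * n + 1))
    [Decidable ((graph M).Adj u v)] :
    graphBit M u v = if (graph M).Adj u v then 1 else 0 := by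
  have hstar : 0 < starBit n u v ↔ u ≠ v ∧ (u = center n ∨ v = center n) := by
    classical
    rw [starBit_eq u v inferInstance, ← SimpleGraph.starGraph_adj]
    split_ifs with h <;> simp only [h, zero_lt_one, lt_irrefl]
  -- The bits contain no test for `u = v`. On the diagonal `n ≤ u` pushes the index beyond the
  -- matrix, where the cells are `0`.
  have hself : ¬ 0 < sideBit M u u := by
    rw [sideBit_pos]
    rintro ⟨h₁, h₂⟩
    exact h₂ (cells_of_le M (by nlinarith))
  have hiff : 0 < starBit n u v + sideBit M u v + sideBit M v u ↔ (graph M).Adj u v := by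
    rw [graph_adj, Nat.add_pos_iff_pos_or_pos, Nat.add_pos_iff_pos_or_pos, hstar]
    by_cases huv : u = v
    · subst huv
      simp [hself]
    · simp only [ne_eq, huv, not_false_eq_true, true_and, sideBit_pos]
      tauto
  rw [graphBit]
  simp only [hiff]

/-- Write cell number `6` (the content of the register) of the matrices. -/
def matBody : Cmd :=
  .block [.op .div 8 6 4, .op .mod 9 6 4,
    .op .eq 10 8 3, .op .eq 11 9 3, .op .eq 10 10 11, .op .eq 10 10 7,
    .store (arrBase + 1) 6 10,
    .op .mul 12 8 0, .op .sub 13 9 0, .op .add 12 12 13, .load 12 0 12,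
    .op .lt 13 9 0, .op .eq 13 13 7, .op .mul 12 12 13, .op .add 10 10 12,
    .op .mul 12 9 0, .op .sub 13 8 0, .op .add 12 12 13, .load 12 0 12,
    .op .lt 13 8 0, .op .eq 13 13 7, .op .mul 12 12 13, .op .add 10 10 12,
    .op .lt 10 7 10,
    .store (arrBase + 0) 6 10, .store (arrBase + 2) 6 10, .store (arrBase + 3) 6 10]

/-- Prepare the input of the TreeFlow data structure and run its preprocessing. -/
def prepProg (D : TreeFlowDS) : Cmd :=
  .block [.const 1 1, .const 7 0, .op .add 3 0 0, .op .add 4 3 1, .op .mul 5 4 4,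
    .forLoop 6 5 matBody,
    .forLoop 6 4 (.block [.store (arrBase + 6) 6 1]),
    .op .add (regBase + 0) 4 7, .op .add (regBase + 1) 3 7, D.prep.shift]

/-- The registers during the preprocessing. -/
def PrepRegs (n k : ℕ) (s : RamState) : Prop :=
  s.reg 0 = n ∧ s.reg 1 = 1 ∧ s.reg 3 = 2 * n ∧ s.reg 4 = 2 * n + 1 ∧
    s.reg 5 = (2 * n + 1) * (2 * n + 1) ∧ s.reg 6 = k ∧ s.reg 7 = 0

/-- The memory of the TreeFlow data structure when `k` cells of the matrices and `l` cells of the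
vector of denominators are written. -/
def partialInput (M : Fin n → Fin n → Bool) (k l : ℕ) : RamState where
  reg _ := 0
  mem a :=
    if a = 0 ∨ a = 2 ∨ a = 3 then
      upTo k fun p => graphBit M (p / (2 * n + 1)) (p % (2 * n + 1))
    else if a = 1 then upTo k fun p => starBit n (p / (2 * n + 1)) (p % (2 * n + 1))
    else if a = 6 then upTo l fun _ => 1
    else fun _ => 0
  used := 0

/-- As all resistances are `1`, their numerators and denominators form the adjacency matrix again,
so one bit serves arrays `0`, `2` and `3`. -/
theorem partialInput_mat (M : Fin n → Fin n → Bool) (k l : ℕ) :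
    ((((partialInput M k l).setCell 1 k (starBit n (k / (2 * n + 1)) (k % (2 * n + 1)))).setCell 0 k
      (graphBit M (k / (2 * n + 1)) (k % (2 * n + 1)))).setCell 2 k
      (graphBit M (k / (2 * n + 1)) (k % (2 * n + 1)))).setCell 3 k
      (graphBit M (k / (2 * n + 1)) (k % (2 * n + 1))) = partialInput M (k + 1) l := by
  have hg := update_upTo k fun p => graphBit M (p / (2 * n + 1)) (p % (2 * n + 1))
  have hs := update_upTo k fun p => starBit n (p / (2 * n + 1)) (p % (2 * n + 1))
  refine ext' rfl (funext fun a => ?_) rfl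
  rcases a with _ | _ | _ | _ | a <;> simp [partialInput, hg, hs]

theorem partialInput_vec (M : Fin n → Fin n → Bool) (k l : ℕ) :
    (partialInput M k l).setCell 6 l 1 = partialInput M k (l + 1) := by
  have hg := update_upTo l fun _ => 1
  refine ext' rfl (funext fun a => ?_) rfl
  by_cases ha : a = 6
  · simp [partialInput, hg, ha]
  · simp [partialInput, ha]

theorem matArr_eq_upTo {N : ℕ} (m : Fin N → Fin N → ℕ) (f : ℕ → ℕ → ℕ)
    (h : ∀ u v : Fin N, f u v = m u v) : matArr m = upTo (N * N) fun p => f (p / N) (p % N) := by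
  funext p
  rw [matArr, vecArr, upTo]
  split_ifs with hp
  · exact (h _ _).symm
  · rfl

/-- Supplies are `0`, with sign and numerator `0` and denominator `1`: arrays `4` and `5` stay
blank, array `6` is filled with ones. -/
theorem partialInput_full (M : Fin n → Fin n → Bool) :
    ((partialInput M ((2 * n + 1) * (2 * n + 1)) (2 * n + 1)).setReg 0 (2 * n + 1)).setReg 1 (2 * n) =
      (input M).initState := by
  classical
  refine ext' rfl (funext fun a => ?_) rfl
  have hr : ∀ e, (input M).r e = 1 := fun _ => rfl
  have hb : ∀ v, (input M).b v = 0 := fun _ => rfl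
  have hg := matArr_eq_upTo (fun u v => if (input M).G.Adj u v then 1 else 0) (graphBit M)
    fun u v => by rw [graphBit_eq]; rfl
  have hs := matArr_eq_upTo (fun u v => if (input M).T.Adj u v then 1 else 0) (starBit n)
    fun u v => starBit_eq u v (_)
  have hz : vecArr (fun _ : Fin (2 * n + 1) => 0) = fun _ => 0 := by
    funext p; simp [vecArr]
  have ho : vecArr (fun _ : Fin (2 * n + 1) => 1) = upTo (2 * n + 1) fun _ => 1 := by
    funext p; simp [vecArr, upTo]
  rcases a with _ | _ | _ | _ | _ | _ | _ | a <;>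
    simp [TreeFlowInput.initState, partialInput, hr, hb, hg, hs, hz, ho, RamState.zero]

theorem halts_matBody {B : ℕ} (ω : ℕ → Bool) (hn : 1 ≤ n) (hB : (2 * n + 1) * (2 * n + 1) < B)
    (M : Fin n → Fin n → Bool) {k : ℕ} (hk : k < (2 * n + 1) * (2 * n + 1)) {s : RamState}
    (hs : PrepRegs n k s) (hM : s.mem 0 = cells M) (hv : s.view = partialInput M k 0) :
    Halts B ω matBody s 28 fun s' =>
      PrepRegs n k s' ∧ s'.mem 0 = cells M ∧ s'.view = partialInput M (k + 1) 0 := by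
  obtain ⟨h0, h1, h3, h4, h5, h6, h7⟩ := hs
  obtain ⟨u, hu⟩ : ∃ u, u = k / (2 * n + 1) := ⟨_, rfl⟩
  obtain ⟨v, hv'⟩ : ∃ v, v = k % (2 * n + 1) := ⟨_, rfl⟩
  have hun : u ≤ 2 * n := by
    rw [hu]; exact Nat.lt_succ_iff.1 (Nat.div_lt_of_lt_mul hk)
  have hvn : v ≤ 2 * n := by
    rw [hv']; exact Nat.lt_succ_iff.1 (Nat.mod_lt _ (by omega))
  have hupd := partialInput_mat M k 0
  rw [← hu, ← hv'] at hupd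
  have hst := starBit_le n u v
  have hsd := sideBit_le M u v
  have hsd' := sideBit_le M v u
  have hgr := graphBit_le M u v
  have hc := cells_le_one M (u * n + (v - n))
  have hc' := cells_le_one M (v * n + (u - n))
  -- These facts make the products linear for `omega`, which then checks that every address and
  -- value stays below `B`.
  have hn4 : 2 * n + 1 ≤ (2 * n + 1) * (2 * n + 1) := Nat.le_mul_self _
  have hu' : u * n ≤ 2 * n * n := Nat.mul_le_mul_right _ hun
  have hv'' : v * n ≤ 2 * n * n := Nat.mul_le_mul_right _ hvn
  have hN : (2 * n + 1) * (2 * n + 1) = 2 * n * n + 2 * n * n + 2 * n + 2 * n + 1 := by ring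
  have hnn : 1 ≤ n * n := Nat.mul_pos (by omega) (by omega)
  have hnn' : 2 * n * n = 2 * (n * n) := by ring
  unfold matBody
  refine .op_cons u (by simp [WordOp.eval, h6, h4, hu]) (by omega) ?_
  refine .op_cons v (by simp [WordOp.eval, h6, h4, hv']) (by omega) ?_
  refine .op_cons (if u = 2 * n then 1 else 0) (by simp [WordOp.eval, h3])
    (by split_ifs <;> omega) ?_
  refine .op_cons (if v = 2 * n then 1 else 0) (by simp [WordOp.eval, h3])
    (by split_ifs <;> omega) ?_
  -- Comparing the two tests gives the negation of the bit; the next comparison, with the `0` in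
  -- register `7`, negates it back.
  refine .op_cons (1 - starBit n u v) ?_ (by omega) ?_
  · simp [WordOp.eval, starBit]
    split_ifs <;> omega
  refine .op_cons (starBit n u v) ?_ (by omega) ?_
  · simp only [WordOp.eval, setReg_reg]
    simp [h7]; split_ifs <;> omega
  refine .store_cons k (starBit n u v) (by simp [h6]) (by simp) (by omega) (by omega) ?_
  refine .op_cons (u * n) (by simp [WordOp.eval, h0]) (by omega) ?_
  refine .op_cons (v - n) (by simp [WordOp.eval, h0]) (by omega) ?_
  refine .op_cons (u * n + (v - n)) (by simp [WordOp.eval]) (by omega) ?_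
  refine .load_cons (cells M (u * n + (v - n))) (by simp [hM]) (by omega) ?_
  refine .op_cons (if v < n then 1 else 0) (by simp [WordOp.eval, h0]) (by split_ifs <;> omega) ?_
  refine .op_cons (if n ≤ v then 1 else 0) (by simp [WordOp.eval, h7]) (by split_ifs <;> omega) ?_
  refine .op_cons (sideBit M u v) (by simp [WordOp.eval, sideBit]) (by omega) ?_
  refine .op_cons (starBit n u v + sideBit M u v) (by simp [WordOp.eval]) (by omega) ?_
  refine .op_cons (v * n) (by simp [WordOp.eval, h0]) (by omega) ?_
  refine .op_cons (u - n) (by simp [WordOp.eval, h0]) (by omega) ?_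
  refine .op_cons (v * n + (u - n)) (by simp [WordOp.eval]) (by omega) ?_
  refine .load_cons (cells M (v * n + (u - n))) (by simp [hM]) (by omega) ?_
  refine .op_cons (if u < n then 1 else 0) (by simp [WordOp.eval, h0]) (by split_ifs <;> omega) ?_
  refine .op_cons (if n ≤ u then 1 else 0) (by simp [WordOp.eval, h7]) (by split_ifs <;> omega) ?_
  refine .op_cons (sideBit M v u) (by simp [WordOp.eval, sideBit]) (by omega) ?_
  refine .op_cons (starBit n u v + sideBit M u v + sideBit M v u) (by simp [WordOp.eval])
    (by omega) ?_
  refine .op_cons (graphBit M u v) (by simp [WordOp.eval, graphBit, h7]) (by omega) ?_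
  refine .store_cons k (graphBit M u v) (by simp [h6]) (by simp) (by omega) (by omega) ?_
  refine .store_cons k (graphBit M u v) (by simp [h6]) (by simp) (by omega) (by omega) ?_
  refine .store_cons k (graphBit M u v) (by simp [h6]) (by simp) (by omega) (by omega) ?_
  refine .nil ⟨⟨?_, ?_, ?_, ?_, ?_, ?_, ?_⟩, ?_, ?_⟩
  · simpa using h0
  · simpa using h1
  · simpa using h3
  · simpa using h4
  · simpa using h5
  · simpa using h6
  · simpa using h7
  · simpa using hM
  · simp only [view_setCell_shift, view_setReg_own, Nat.reduceLT, hv, hupd]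

theorem halts_prepProg {B B₀ : ℕ} (ω : ℕ → Bool) (hn : 1 ≤ n)
    (hB : (2 * n + 1) * (2 * n + 1) < B) (hB₀ : B₀ ≤ B) (D : TreeFlowDS)
    (M : Fin n → Fin n → Bool) {t T : ℕ} {s₁ : RamState}
    (hr : Runs B₀ ω D.prep (input M).initState t s₁) (ht : t ≤ T) :
    Halts B ω (prepProg D) (OMvAlg.initState M)
      (T + 32 * ((2 * n + 1) * (2 * n + 1)) + 6 * (2 * n + 1) + 16) fun s' =>
        s'.reg 0 = n ∧ s'.view = s₁ := by
  have hn4 : 2 * n + 1 ≤ (2 * n + 1) * (2 * n + 1) := Nat.le_mul_self _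
  obtain ⟨N, hN⟩ : ∃ N, N = (2 * n + 1) * (2 * n + 1) := ⟨_, rfl⟩
  -- Per matrix cell: the `28` steps of `matBody` and `4` for the loop. Per denominator: `2` for the
  -- body and `4` for the loop.
  have hT : T + 32 * ((2 * n + 1) * (2 * n + 1)) + 6 * (2 * n + 1) + 16 =
      (N * (28 + 4) + 4) + (((2 * n + 1) * (2 + 4) + 4) + ((T + 1) + 1 + 1)) + 1 + 1 + 1 + 1 + 1 := by
    rw [hN]; ring
  rw [hT]
  unfold prepProg
  refine .const_cons (by omega) (.const_cons (by omega) ?_)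
  refine .op_cons (2 * n) (by simp [WordOp.eval, OMvAlg.initState]; omega) (by omega) ?_
  refine .op_cons (2 * n + 1) (by simp [WordOp.eval, OMvAlg.initState]) (by omega) ?_
  refine .op_cons N (by simp [WordOp.eval, OMvAlg.initState, hN]) (by omega) ?_
  have hview : (OMvAlg.initState M).view = partialInput M 0 0 := by
    refine ext' (funext fun i => ?_) (funext fun a => ?_) rfl
    · simp [OMvAlg.initState, RamState.zero, partialInput]
    · simp [OMvAlg.initState, RamState.zero, partialInput, upTo_zero]
  refine .cons (.forLoop (m := N) (fun k s => PrepRegs n k s ∧ s.mem 0 = cells M ∧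
    s.view = partialInput M k 0) (by omega) (by omega) ?_ ?_ ?_ ?_ ?_)
  · rintro k s ⟨⟨h0, h1, h3, h4, h5, h6, h7⟩, -⟩
    exact ⟨h5.trans hN.symm, h1, h6⟩
  · refine ⟨⟨?_, ?_, ?_, ?_, ?_, ?_, ?_⟩, ?_, ?_⟩
    · simp [OMvAlg.initState]
    · simp
    · simp
    · simp
    · simp [hN]
    · simp
    · simp
    · simp [OMvAlg.initState, cells]
    · simp only [view_setReg_own, Nat.reduceLT, hview]
  · rintro k s x ⟨⟨h0, h1, h3, h4, h5, h6, h7⟩, hM, hv⟩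
    refine ⟨by simp [PrepRegs, *], hM, ?_⟩
    rw [view_setReg_own _ (by norm_num), hv]
  · rintro k s hk ⟨hs, hM, hv⟩
    refine (halts_matBody ω hn hB M (hN ▸ hk) hs hM hv).mono le_rfl ?_
    rintro s' ⟨⟨h0, h1, h3, h4, h5, h6, h7⟩, hM, hv⟩
    refine ⟨h6, h1, by simp [PrepRegs, *], hM, ?_⟩
    rw [view_setReg_own _ (by norm_num), hv]
  rintro s ⟨⟨h0, h1, h3, h4, h5, h6, h7⟩, hM, hv⟩
  refine .cons (.forLoop (m := 2 * n + 1) (fun k s => PrepRegs n k s ∧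
    s.view = partialInput M N k) (by omega) (by omega) ?_ ?_ ?_ ?_ ?_)
  · rintro k s ⟨⟨h0, h1, h3, h4, h5, h6, h7⟩, -⟩
    exact ⟨h4, h1, h6⟩
  · refine ⟨by simp [PrepRegs, *], ?_⟩
    rw [view_setReg_own _ (by norm_num), hv]
  · rintro k s x ⟨⟨h0, h1, h3, h4, h5, h6, h7⟩, hv⟩
    refine ⟨by simp [PrepRegs, *], ?_⟩
    rw [view_setReg_own _ (by norm_num), hv]
  · rintro k s hk ⟨⟨h0, h1, h3, h4, h5, h6, h7⟩, hv⟩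
    refine .store_cons k 1 h6 h1 (by omega) (by omega) (.nil ⟨h6, h1, by simp [PrepRegs, *], ?_⟩)
    rw [view_setReg_own _ (by norm_num), view_setCell_shift, hv, partialInput_vec]
  rintro s ⟨⟨h0, h1, h3, h4, h5, h6, h7⟩, hv⟩
  refine .op_cons (2 * n + 1) (by simp [WordOp.eval, *]) (by omega) ?_
  refine .op_cons (2 * n) ?_ (by omega) ?_
  · simp [WordOp.eval, *]
  refine .cons (.shift hB₀ hr ht ?_ fun s' hv' ho => .nil ⟨?_, hv'⟩)
  · rw [view_setReg_shift, view_setReg_shift, hv, hN, partialInput_full]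
  · rw [← ho.1 0 (by norm_num)]
    simp only [setReg_shift_reg, Nat.reduceLT, h0]

end OMvReduction

/-! ### The query program -/

namespace OMvReduction

open RamState

variable {n : ℕ}

/-- Call `addvalue` for column number `6` (the content of the register) with the coordinate of the
vector in this column; the sign is taken from register `sg`. -/
def addBody (D : TreeFlowDS) (sg : ℕ) : Cmd :=
  .block [.load 8 1 6, .op .add (regBase + 0) 0 6, .op .add (regBase + 1) sg 7,
    .op .add (regBase + 2) 8 7, .op .add (regBase + 3) 1 7, D.add.shift]

/-- Call `findflow` for row number `6` (the content of the register) and store whether the answer is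
nonzero. -/
def findBody (D : TreeFlowDS) : Cmd :=
  .block [.op .add (regBase + 0) 6 7, D.find.shift, .op .lt 8 7 (regBase + 2), .store 2 6 8]

/-- Process one vector. -/
def queryProg (D : TreeFlowDS) : Cmd :=
  .block [.const 1 1, .const 7 0, .forLoop 6 0 (addBody D 7), .forLoop 6 0 (findBody D),
    .forLoop 6 0 (addBody D 8)]

/-- The OMv algorithm that uses a TreeFlow data structure. -/
def alg (D : TreeFlowDS) : OMvAlg := ⟨prepProg D, queryProg D⟩

/-- The registers and the input vector while a vector is processed. -/
def QueryRegs (v : Fin n → Bool) (k : ℕ) (s : RamState) : Prop :=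
  s.reg 0 = n ∧ s.reg 1 = 1 ∧ s.reg 6 = k ∧ s.reg 7 = 0 ∧ ∀ j : Fin n, s.mem 1 j = coord v j

theorem QueryRegs.setReg {v : Fin n → Bool} {k : ℕ} {s : RamState} (h : QueryRegs v k s) (x : ℕ) :
    QueryRegs v k (s.setReg 2 x) := by
  obtain ⟨h0, h1, h6, h7, hv⟩ := h
  simpa [QueryRegs, h0, h1, h6, h7] using hv

theorem QueryRegs.setCtr {v : Fin n → Bool} {k : ℕ} {s : RamState} (h : QueryRegs v k s) (x : ℕ) :
    QueryRegs v x (s.setReg 6 x) := by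
  obtain ⟨h0, h1, h6, h7, hv⟩ := h
  simpa [QueryRegs, h0, h1, h6, h7] using hv

theorem QueryRegs.sameOwn {v : Fin n → Bool} {k : ℕ} {s s' : RamState} (h : QueryRegs v k s)
    (ho : SameOwn s s') : QueryRegs v k s' := by
  obtain ⟨h0, h1, h6, h7, hv⟩ := h
  simp only [QueryRegs, ← ho.1 0 (by norm_num), ← ho.1 1 (by norm_num), ← ho.1 6 (by norm_num),
    ← ho.1 7 (by norm_num), ← ho.2 1 (by norm_num)]
  exact ⟨h0, h1, h6, h7, hv⟩

variable {B B₀ T : ℕ} {ω : ℕ → Bool} {τ : ℝ} {D : TreeFlowDS}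

/-- Insertion and removal of a coordinate differ only in the sign, so `x j` stands for either and
`sg` is the register that holds its sign. The run of `D.add` is extracted from the assumed service
of the operation and mirrored in the larger machine. -/
theorem halts_addBody (hB : 2 * n + 1 < B) (hB₀ : B₀ ≤ B) (hT : ∀ t : ℕ, (t : ℝ) ≤ τ → t ≤ T)
    {v : Fin n → Bool} {sg : ℕ} {x : Fin n → ℚ}
    (hsg : sg < 32) (j : Fin n) {s : RamState} (hs : QueryRegs v j s)
    (hsgn : (s.setReg 8 (coord v j)).reg sg = if x j < 0 then 1 else 0)
    (hnum : (x j).num.natAbs = coord v j) (hden : (x j).den = 1)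
    {ops : List (TreeFlowOp (2 * n + 1))} {outs : List RamState}
    (hser : D.Serves B₀ ω τ s.view (.addvalue (colVert j) (x j) :: ops) outs) :
    Halts B ω (addBody D sg) s (T + 6) fun s' =>
      QueryRegs v j s' ∧ s'.mem 2 = s.mem 2 ∧ D.Serves B₀ ω τ s'.view ops outs := by
  cases hser with
  | addvalue _ s₁ _ _ t _ _ hr ht hser =>
  have hcoord := coord_le_one v j
  have hj := j.2
  obtain ⟨h0, h1, h6, h7, hv⟩ := hs
  unfold addBody
  refine .load_cons (coord v j) (by rw [h6, hv]) (by omega) ?_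
  refine .op_cons (n + j) (by simp [WordOp.eval, h0, h6]) (by omega) ?_
  refine .op_cons (if x j < 0 then 1 else 0) ?_ (by split_ifs <;> omega) ?_
  · simp only [WordOp.eval, setReg_shift_reg _ _ _ hsg, hsgn, setReg_shift_reg, Nat.reduceLT]
    simp [h7]
  refine .op_cons (coord v j) (by simp [WordOp.eval, h7]) (by omega) ?_
  refine .op_cons 1 (by simp [WordOp.eval, h1, h7]) (by omega) ?_
  refine .cons (.shift hB₀ hr (hT t ht) ?_ fun s' hv' ho => .nil ⟨?_, ?_, ?_⟩)
  · simp only [view_setReg_shift, TreeFlowDS.giveAdd, hnum, hden, colVert]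
    rw [view_setReg_own _ (by norm_num)]
  · refine QueryRegs.sameOwn ?_ ho
    simpa [QueryRegs, h0, h1, h6, h7] using hv
  · rw [← ho.2 2 (by norm_num)]
    simp
  · rwa [hv']

theorem halts_findBody (hB : 2 * n + 1 < B) (hB₀ : B₀ ≤ B) (hT : ∀ t : ℕ, (t : ℝ) ≤ τ → t ≤ T)
    {v : Fin n → Bool} (j : Fin n) {s : RamState} (hs : QueryRegs v j s)
    {ops : List (TreeFlowOp (2 * n + 1))} {outs : List RamState}
    (hser : D.Serves B₀ ω τ s.view (findOp j :: ops) outs) :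
    Halts B ω (findBody D) s (T + 4) fun s' => ∃ d rest, outs = d :: rest ∧
      QueryRegs v j s' ∧ D.Serves B₀ ω τ s'.view ops rest ∧
      s'.mem 2 = Function.update (s.mem 2) j (if 0 < d.reg 2 then 1 else 0) := by
  cases hser with
  | findflow _ s₁ _ t _ rest hr ht hser =>
  have hj := j.2
  unfold findBody
  refine .op_cons j (by simp [WordOp.eval, hs.2.2.1, hs.2.2.2.1]) (by omega) ?_
  refine Halts.mono (T := T + (1 + 1 + 1)) (.cons (.shift hB₀ hr (hT t ht) ?_ fun s' hv' ho => ?_))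
    (by omega) fun _ h => h
  · rw [view_setReg_shift]; rfl
  have hs' : QueryRegs v j s' := hs.sameOwn ((sameOwn_setReg _ _ _).trans ho)
  have hm2 : s'.mem 2 = s.mem 2 := (ho.2 2 (by norm_num)).symm
  obtain ⟨h0, h1, h6, h7, hv⟩ := hs'
  have hd : s₁.reg 2 = s'.reg (regBase + 2) := by rw [← hv', view_reg]
  refine .op_cons (if 0 < s₁.reg 2 then 1 else 0) (by rw [WordOp.eval, h7, hd])
    (by split_ifs <;> omega) ?_
  refine .store_cons j (if 0 < s₁.reg 2 then 1 else 0) (by simp [h6]) (by simp) (by omega)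
    (by split_ifs <;> omega) (.nil ⟨s₁, rest, rfl, ?_, ?_, ?_⟩)
  · simpa [QueryRegs, h0, h1, h6, h7] using hv
  · rw [view_setCell_own _ (by norm_num), view_setReg_own _ (by norm_num), hv']
    exact hser
  · simp [hm2]

theorem halts_addLoop (hB : 2 * n + 1 < B) (hB₀ : B₀ ≤ B) (hT : ∀ t : ℕ, (t : ℝ) ≤ τ → t ≤ T)
    {v : Fin n → Bool} {sg : ℕ} {x : Fin n → ℚ} (hsg : sg < 32)
    (hsgn : ∀ (j : Fin n) s, QueryRegs v j s →
      (s.setReg 8 (coord v j)).reg sg = if x j < 0 then 1 else 0)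
    (hnum : ∀ j, (x j).num.natAbs = coord v j) (hden : ∀ j, (x j).den = 1)
    {k : ℕ} {s : RamState} (hs : QueryRegs v k s)
    {ops : List (TreeFlowOp (2 * n + 1))} {outs : List RamState}
    (hser : D.Serves B₀ ω τ s.view
      (opsFrom (fun j => .addvalue (colVert j) (x j)) 0 ++ ops) outs) :
    Halts B ω (.forLoop 6 0 (addBody D sg)) s (n * (T + 10) + 4) fun s' =>
      QueryRegs v n s' ∧ s'.mem 2 = s.mem 2 ∧ D.Serves B₀ ω τ s'.view ops outs := by
  refine .forLoop (m := n) (T := T + 6) (fun k s' => QueryRegs v k s' ∧ s'.mem 2 = s.mem 2 ∧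
    D.Serves B₀ ω τ s'.view (opsFrom (fun j => .addvalue (colVert j) (x j)) k ++ ops) outs)
    (by omega) (by omega) ?_ ?_ ?_ ?_ ?_
  · rintro k s' ⟨⟨h0, h1, h6, h7, hv⟩, -⟩
    exact ⟨h0, h1, h6⟩
  · exact ⟨hs.setCtr 0, rfl, by rwa [view_setReg_own _ (by norm_num)]⟩
  · rintro k s' y ⟨hs', hm, hser⟩
    exact ⟨hs'.setReg y, hm, by rwa [view_setReg_own _ (by norm_num)]⟩
  · rintro k s' hk ⟨hs', hm, hser⟩
    have hcons := opsFrom_lt (fun j : Fin n => TreeFlowOp.addvalue (colVert j) (x j)) ⟨k, hk⟩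
    simp only at hcons
    rw [hcons, List.cons_append] at hser
    refine (halts_addBody hB hB₀ hT hsg ⟨k, hk⟩ hs' (hsgn _ _ hs') (hnum _) (hden _) hser).mono
      le_rfl ?_
    rintro s'' ⟨hs'', hm', hser'⟩
    exact ⟨hs''.2.2.1, hs''.2.1, hs''.setCtr _, hm'.trans hm,
      by rwa [view_setReg_own _ (by norm_num)]⟩
  · rintro s' ⟨hs', hm, hser⟩
    rw [opsFrom_self, List.nil_append] at hser
    exact ⟨hs', hm, hser⟩

/-- The invariant splits `outs` into the `k` states already reached and those still to come; the
first `k` cells of array `2` record which of the former returned a nonzero numerator. -/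
theorem halts_findLoop (hB : 2 * n + 1 < B) (hB₀ : B₀ ≤ B) (hT : ∀ t : ℕ, (t : ℝ) ≤ τ → t ≤ T)
    {v : Fin n → Bool} {k : ℕ} {s : RamState} (hs : QueryRegs v k s)
    {ops : List (TreeFlowOp (2 * n + 1))} {outs : List RamState}
    (hser : D.Serves B₀ ω τ s.view (opsFrom findOp 0 ++ ops) outs) :
    Halts B ω (.forLoop 6 0 (findBody D)) s (n * (T + 10) + 4) fun s' =>
      ∃ found rest, outs = found ++ rest ∧ found.length = n ∧
        (∀ i d, found[i]? = some d → s'.mem 2 i = if 0 < d.reg 2 then 1 else 0) ∧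
        QueryRegs v n s' ∧ D.Serves B₀ ω τ s'.view ops rest := by
  -- The body needs only `T + 4` steps; the slack makes all three loops cost the same.
  refine .forLoop (m := n) (T := T + 6) (fun k s' => ∃ found rest, outs = found ++ rest ∧
      found.length = k ∧
      (∀ i d, found[i]? = some d → s'.mem 2 i = if 0 < d.reg 2 then 1 else 0) ∧
      QueryRegs v k s' ∧ D.Serves B₀ ω τ s'.view (opsFrom findOp k ++ ops) rest)
    (by omega) (by omega) ?_ ?_ ?_ ?_ ?_
  · rintro k s' ⟨-, -, -, -, -, ⟨h0, h1, h6, h7, hv⟩, -⟩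
    exact ⟨h0, h1, h6⟩
  · exact ⟨[], outs, rfl, rfl, by simp, hs.setCtr 0, by rwa [view_setReg_own _ (by norm_num)]⟩
  · rintro k s' y ⟨found, rest, he, hl, hm, hs', hser⟩
    exact ⟨found, rest, he, hl, hm, hs'.setReg y, by rwa [view_setReg_own _ (by norm_num)]⟩
  · rintro k s' hk ⟨found, rest, he, hl, hm, hs', hser⟩
    have hcons := opsFrom_lt (findOp (n := n)) ⟨k, hk⟩
    simp only at hcons
    rw [hcons, List.cons_append] at hser
    refine (halts_findBody hB hB₀ hT ⟨k, hk⟩ hs' hser).mono (by omega) ?_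
    rintro s'' ⟨d, rest', rfl, hs'', hser', hm'⟩
    refine ⟨hs''.2.2.1, hs''.2.1, found ++ [d], rest', by simp [he], by simp [hl], ?_,
      hs''.setCtr _, by rwa [view_setReg_own _ (by norm_num)]⟩
    intro i e hi
    rw [setReg_mem, hm', Function.update_apply]
    by_cases hik : i = k
    · subst hik
      rw [if_pos rfl]
      rw [List.getElem?_append_right (by omega), hl, Nat.sub_self] at hi
      obtain rfl : d = e := by simpa using hi
      rfl
    · rw [if_neg hik]
      refine hm i e ?_
      rw [← hi, List.getElem?_append_left]
      have := (List.getElem?_eq_some_iff.1 hi).1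
      simp at this
      omega
  · rintro s' ⟨found, rest, he, hl, hm, hs', hser⟩
    rw [opsFrom_self, List.nil_append] at hser
    exact ⟨found, rest, he, hl, hm, hs', hser⟩

theorem halts_queryProg (hB : 2 * n + 1 < B) (hB₀ : B₀ ≤ B)
    (hT : ∀ t : ℕ, (t : ℝ) ≤ τ → t ≤ T) (v : Fin n → Bool) {s : RamState} (h0 : s.reg 0 = n)
    {ops : List (TreeFlowOp (2 * n + 1))} {outs : List RamState}
    (hser : D.Serves B₀ ω τ s.view (roundOps v ops) outs) :
    Halts B ω (queryProg D) (OMvAlg.giveVec v s) (3 * (n * (T + 10)) + 15) fun s' =>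
      ∃ found rest, outs = found ++ rest ∧ found.length = n ∧
        (∀ i d, found[i]? = some d → s'.mem 2 i = if 0 < d.reg 2 then 1 else 0) ∧
        s'.reg 0 = n ∧ D.Serves B₀ ω τ s'.view ops rest := by
  have hT' : 3 * (n * (T + 10)) + 15 = (n * (T + 10) + 4) + ((n * (T + 10) + 4) +
      ((n * (T + 10) + 4) + 1)) + 1 + 1 := by ring
  rw [hT']
  refine .const_cons (by omega) (.const_cons (by omega) ?_)
  have hs : QueryRegs v (s.reg 6) (((OMvAlg.giveVec v s).setReg 1 1).setReg 7 0) := by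
    refine ⟨by simp [OMvAlg.giveVec, h0], by simp, by simp [OMvAlg.giveVec], by simp, fun j => ?_⟩
    simp [OMvAlg.giveVec, coord_apply]
  have hview : (((OMvAlg.giveVec v s).setReg 1 1).setReg 7 0).view = s.view := by
    rw [view_setReg_own _ (by norm_num), view_setReg_own _ (by norm_num), OMvAlg.giveVec,
      view_setArr_own _ (by norm_num)]
  rw [← hview] at hser
  refine .cons ((halts_addLoop hB hB₀ hT (x := fun j => (coord v j : ℚ)) (by norm_num) ?_
    (fun j => by simp) (fun j => by simp) hs hser).mono le_rfl ?_)
  · rintro j s ⟨-, -, -, h7, -⟩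
    rw [if_neg (by simp)]
    simpa using h7
  rintro s₁ ⟨hs₁, -, hser₁⟩
  refine .cons ((halts_findLoop hB hB₀ hT hs₁ hser₁).mono le_rfl ?_)
  rintro s₂ ⟨found, rest, he, hl, hm, hs₂, hser₂⟩
  refine .cons ((halts_addLoop hB hB₀ hT (x := fun j => -(coord v j : ℚ)) (by norm_num) ?_
    (fun j => by simp) (fun j => by simp) hs₂ hser₂).mono le_rfl ?_)
  -- Register `8` holds the coordinate itself, which is `1` exactly when its negation is below zero,
  -- so it doubles as the sign.
  · intro j s _
    have := coord_le_one v j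
    interval_cases h : coord v j <;> simp
  rintro s₃ ⟨hs₃, hm₃, hser₃⟩
  exact .nil ⟨found, rest, he, hl, by rwa [hm₃], hs₃.1, hser₃⟩

theorem returns_of_approx {α : ℝ} (hα : 1 ≤ α) (M : Fin n → Fin n → Bool) (v : Fin n → Bool)
    {found : List RamState} {s : RamState}
    (hm : ∀ i d, found[i]? = some d → s.mem 2 i = if 0 < d.reg 2 then 1 else 0)
    (h : List.Forall₂ (TreeFlowDS.ReturnsApprox α) found
      ((List.finRange n).map fun i => (count M v i : ℚ))) :
    OMvAlg.Returns s (boolMulVec M v) := by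
  intro i
  have hl : (i : ℕ) < found.length := by
    rw [h.length_eq]; simp
  have hi := h.get hl (by simp)
  simp only [List.get_eq_getElem, List.getElem_map, List.getElem_finRange, Fin.cast_mk,
    Fin.eta] at hi
  have hpos := (returnsApprox_iff hα hi).trans (count_pos_iff M v i)
  rw [hm i _ (List.getElem?_eq_getElem hl)]
  cases hb : boolMulVec M v i <;> simp [hpos, hb]

/-- Existence and duration of the OMv rounds need only that the structure halts in time; correctness
is a separate implication, because it is available only on good tapes. Each vector consumes `n` of
the answers, so both lists are split after `n` entries. -/
theorem rounds_of_serves (hB : 2 * n + 1 < B) (hB₀ : B₀ ≤ B)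
    (hT : ∀ t : ℕ, (t : ℝ) ≤ τ → t ≤ T) {α : ℝ} (hα : 1 ≤ α) (M : Fin n → Fin n → Bool)
    (vs : List (Fin n → Bool)) {s : RamState} (h0 : s.reg 0 = n) {outs : List RamState}
    (hser : D.Serves B₀ ω τ s.view (allOps vs) outs) :
    ∃ t states, (alg D).Rounds B ω s vs t states ∧
      t ≤ vs.length * (3 * (n * (T + 10)) + 15) ∧
      (List.Forall₂ (TreeFlowDS.ReturnsApprox α) outs
          ((input M).answers (fun _ => 0) (allOps vs)) →
        List.Forall₂ (fun s v => OMvAlg.Returns s (boolMulVec M v)) states vs) := by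
  induction vs generalizing s outs with
  | nil => exact ⟨0, [], .nil s, by simp, fun _ => .nil⟩
  | cons v vs ih =>
    obtain ⟨t, s', hr, ht, found, rest, rfl, hl, hm, h0', hser'⟩ :=
      halts_queryProg hB hB₀ hT v h0 hser
    obtain ⟨t', states, hrs, ht', hcorr⟩ := ih h0' hser'
    refine ⟨t + t', s' :: states, .cons _ _ _ _ _ _ _ hr hrs, ?_, fun h => ?_⟩
    · rw [List.length_cons, add_mul]; omega
    · rw [allOps, answers_roundOps] at h
      have h₁ := List.forall₂_take_append _ _ _ h
      have h₂ := List.forall₂_drop_append _ _ _ h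
      rw [List.length_map, List.length_finRange, List.take_left' hl] at h₁
      rw [List.length_map, List.length_finRange, List.drop_left' hl] at h₂
      exact .cons (returns_of_approx hα M v hm h₁) (hcorr h₂)

end OMvReduction

/-! ### Word sizes and running times -/

namespace OMvReduction

open RamState

theorem log_two_mul_add_one_le (n : ℕ) : Nat.log 2 (2 * n + 1) ≤ Nat.log 2 n + 1 := by
  have h := Nat.lt_pow_succ_log_self (b := 2) (by norm_num) n
  refine Nat.lt_succ_iff.1 (Nat.log_lt_of_lt_pow (by omega) ?_)
  rw [Nat.succ_eq_add_one] at *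
  rw [pow_succ]
  omega

theorem lt_wordBound {a : ℕ} (ha : 1 ≤ a) (n : ℕ) : n < wordBound a n :=
  (Nat.lt_pow_succ_log_self (by norm_num) n).trans_le
    (Nat.pow_le_pow_right (by norm_num) (Nat.le_mul_of_pos_left _ ha))

/-- Passing from `n` to `2 * n + 1` adds at most one to the logarithm, so doubling `c` is enough;
the extra `4` is for `sq_lt_wordBound`. -/
theorem wordBound_mono (c n : ℕ) : wordBound c (2 * n + 1) ≤ wordBound (2 * c + 4) n := by
  refine Nat.pow_le_pow_right (by norm_num) ?_
  have := log_two_mul_add_one_le n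
  nlinarith [Nat.mul_le_mul_left c this]

theorem sq_lt_wordBound (c n : ℕ) : (2 * n + 1) * (2 * n + 1) < wordBound (2 * c + 4) n := by
  have h := lt_wordBound (le_refl 1) (2 * n + 1)
  refine (Nat.mul_lt_mul'' h h).trans_le ?_
  rw [wordBound, ← pow_add]
  refine Nat.pow_le_pow_right (by norm_num) ?_
  have := log_two_mul_add_one_le n
  nlinarith

/-- Since `2 * n + 1 ≤ 3 * n`, preprocessing contributes `27 * |C|` and the `3 * n ^ 2` operations
`9 * |C|`, together `36 * |C|`. The overhead is at most `(288 + 18 + 16 + 45) * n ^ 2`, and `n ^ 2 ≤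
n ^ (3 - δ)` because `δ ≤ 1`. -/
theorem total_time_le {n t : ℕ} (hn : 1 ≤ n) {ε C : ℝ} (hε : 0 < ε)
    (ht : t ≤ (⌊C * ((2 * n + 1 : ℕ) : ℝ) ^ (3 - ε)⌋₊ + 32 * ((2 * n + 1) * (2 * n + 1)) +
      6 * (2 * n + 1) + 16) + n * (3 * (n * (⌊C * ((2 * n + 1 : ℕ) : ℝ) ^ (1 - ε)⌋₊ + 10)) + 15)) :
    (t : ℝ) ≤ (36 * |C| + 367) * (n : ℝ) ^ (3 - min ε 1) := by
  set δ := min ε 1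
  have hδ0 : 0 < δ := lt_min hε one_pos
  have hδ1 : δ ≤ 1 := min_le_right _ _
  have hδε : δ ≤ ε := min_le_left _ _
  have hn' : (1 : ℝ) ≤ n := by exact_mod_cast hn
  have hN1 : (1 : ℝ) ≤ ((2 * n + 1 : ℕ) : ℝ) := by push_cast; linarith
  have hN3 : ((2 * n + 1 : ℕ) : ℝ) ≤ 3 * n := by push_cast; linarith
  -- Used for `m = 3` and `m = 1`. With `δ ≤ 1 ≤ m` the exponent `m - δ` is nonnegative, so the
  -- power is monotone in its base; `m - ε` may be negative.
  have key : ∀ m : ℕ, 1 ≤ m → (⌊C * ((2 * n + 1 : ℕ) : ℝ) ^ ((m : ℝ) - ε)⌋₊ : ℝ) ≤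
      |C| * (3 ^ m * (n : ℝ) ^ ((m : ℝ) - δ)) := by
    intro m hm
    have hm' : (1 : ℝ) ≤ m := by exact_mod_cast hm
    have hpow : ((2 * n + 1 : ℕ) : ℝ) ^ ((m : ℝ) - ε) ≤ 3 ^ m * (n : ℝ) ^ ((m : ℝ) - δ) :=
      calc ((2 * n + 1 : ℕ) : ℝ) ^ ((m : ℝ) - ε)
          ≤ ((2 * n + 1 : ℕ) : ℝ) ^ ((m : ℝ) - δ) :=
            Real.rpow_le_rpow_of_exponent_le hN1 (by linarith)
        _ ≤ (3 * n : ℝ) ^ ((m : ℝ) - δ) := Real.rpow_le_rpow (by linarith) hN3 (by linarith)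
        _ = 3 ^ ((m : ℝ) - δ) * (n : ℝ) ^ ((m : ℝ) - δ) :=
            Real.mul_rpow (by norm_num) (by linarith)
        _ ≤ 3 ^ m * (n : ℝ) ^ ((m : ℝ) - δ) := by
            refine mul_le_mul_of_nonneg_right ?_ (Real.rpow_nonneg (by linarith) _)
            rw [← Real.rpow_natCast]
            exact Real.rpow_le_rpow_of_exponent_le (by norm_num) (by linarith)
    have hpos : 0 ≤ ((2 * n + 1 : ℕ) : ℝ) ^ ((m : ℝ) - ε) := Real.rpow_nonneg (by linarith) _
    calc (⌊C * ((2 * n + 1 : ℕ) : ℝ) ^ ((m : ℝ) - ε)⌋₊ : ℝ)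
        -- The constant `C` is not assumed nonnegative.
        ≤ (⌊|C| * ((2 * n + 1 : ℕ) : ℝ) ^ ((m : ℝ) - ε)⌋₊ : ℝ) := by
          exact_mod_cast Nat.floor_le_floor (mul_le_mul_of_nonneg_right (le_abs_self C) hpos)
      _ ≤ |C| * ((2 * n + 1 : ℕ) : ℝ) ^ ((m : ℝ) - ε) :=
          Nat.floor_le (mul_nonneg (abs_nonneg C) hpos)
      _ ≤ _ := mul_le_mul_of_nonneg_left hpow (abs_nonneg C)
  have hT₁ := key 3 (by norm_num)
  have hT₂ := key 1 le_rfl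
  simp only [Nat.cast_ofNat, Nat.cast_one, pow_one] at hT₁ hT₂
  set X := (n : ℝ) ^ (3 - δ)
  have hY : (n : ℝ) * n * (n : ℝ) ^ (1 - δ) = X := by
    have h2 : (n : ℝ) * n = (n : ℝ) ^ (2 : ℝ) := by
      rw [Real.rpow_two, sq]
    rw [h2, ← Real.rpow_add (by linarith)]
    congr 1
    ring
  have hX : (n : ℝ) * n ≤ X := by
    rw [← hY]
    exact le_mul_of_one_le_right (by positivity) (Real.one_le_rpow hn' (by linarith))
  have hnn : (n : ℝ) ≤ n * n := by nlinarith
  have hT₂' := mul_le_mul_of_nonneg_left hT₂ (by positivity : (0 : ℝ) ≤ 3 * (n * n))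
  have hT₂'' : 3 * ((n : ℝ) * n) * (|C| * (3 * (n : ℝ) ^ (1 - δ))) = 9 * |C| * X := by
    rw [← hY]; ring
  rw [hT₂''] at hT₂'
  have ht' : (t : ℝ) ≤ _ := Nat.cast_le.2 ht
  generalize ⌊C * ((2 * n + 1 : ℕ) : ℝ) ^ (3 - ε)⌋₊ = T₁ at *
  generalize ⌊C * ((2 * n + 1 : ℕ) : ℝ) ^ (1 - ε)⌋₊ = T₂ at *
  push_cast at ht'
  nlinarith

/-! ### From TreeFlow runs to OMv runs on the same tape. -/

theorem fullRun_of_fullRun {n c : ℕ} (hn : 1 ≤ n) {ε C : ℝ} (hε : 0 < ε) {D : TreeFlowDS}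
    {α : ℝ} (hα : 1 ≤ α) (M : Fin n → Fin n → Bool) {vs : List (Fin n → Bool)}
    (hvs : vs.length = n) {ω : ℕ → Bool} {outs : List RamState}
    (h : D.FullRun (wordBound c (2 * n + 1)) ω (C * ((2 * n + 1 : ℕ) : ℝ) ^ (3 - ε))
      (C * ((2 * n + 1 : ℕ) : ℝ) ^ (1 - ε)) (input M) (allOps vs) outs) :
    ∃ t states, (alg D).FullRun (wordBound (2 * c + 4) n) ω M vs t states ∧
      (t : ℝ) ≤ (36 * |C| + 367) * (n : ℝ) ^ (3 - min ε 1) ∧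
      (List.Forall₂ (TreeFlowDS.ReturnsApprox α) outs
          ((input M).answers (fun _ => 0) (allOps vs)) →
        List.Forall₂ (fun s v => OMvAlg.Returns s (boolMulVec M v)) states vs) := by
  obtain ⟨t₀, s₀, hr, ht₀, hser⟩ := h
  have hB := sq_lt_wordBound c n
  have hB₀ := wordBound_mono c n
  obtain ⟨t₁, s₁, hr₁, ht₁, h0, rfl⟩ := halts_prepProg ω hn hB hB₀ D M hr (Nat.le_floor ht₀)
  obtain ⟨t₂, states, hrs, ht₂, hcorr⟩ := rounds_of_serves ((Nat.le_mul_self _).trans_lt hB) hB₀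
    (fun _ ht => Nat.le_floor ht) hα M vs h0 hser
  refine ⟨t₁ + t₂, states, ⟨t₁, t₂, s₁, hr₁, hrs, rfl⟩, total_time_le hn hε ?_, hcorr⟩
  rw [hvs] at ht₂
  exact add_le_add ht₁ ht₂

theorem solves_alg {D : TreeFlowDS} {a k c : ℕ} (ha : 1 ≤ a) (hk : 2 ≤ k) {α : ℕ → ℝ}
    (hα : ∀ n, 1 ≤ α n) {ε C : ℝ} (hε : 0 < ε) (hD : D.Implements a k α ε c C) :
    (alg D).Solves (2 * c + 4) (36 * |C| + 367) (min ε 1) := by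
  intro n hn M vs hvs
  have hB := lt_wordBound ha (2 * n + 1)
  have hlen : (allOps vs).length ≤ (2 * n + 1) ^ k := by
    rw [allOps_length, hvs]
    -- The only place where `k ≥ 2` matters.
    calc n * (3 * n) ≤ (2 * n + 1) ^ 2 := by nlinarith
      _ ≤ (2 * n + 1) ^ k := Nat.pow_le_pow_right (by omega) hk
  obtain ⟨hrun, herr⟩ := hD (2 * n + 1) (by omega) (input M) (allOps vs)
    (fits_input (by omega) M) (admissible_allOps (by omega) (by omega) M vs) hlen
  -- Tape by tape, a correct TreeFlow run yields a correct OMv run, so the OMv error event lies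
  -- inside the TreeFlow error event.
  refine ⟨fun ω => ?_, (MeasureTheory.measure_mono fun ω hω => ?_).trans herr⟩
  · obtain ⟨outs, h⟩ := hrun ω
    obtain ⟨t, states, hf, ht, -⟩ := fullRun_of_fullRun hn hε (hα (2 * n + 1)) M hvs h
    exact ⟨t, states, hf, ht⟩
  · rintro ⟨outs, h, hout⟩
    obtain ⟨t, states, hf, -, hcorr⟩ := fullRun_of_fullRun hn hε (hα (2 * n + 1)) M hvs h
    exact hω ⟨t, states, hf, hcorr hout⟩

end OMvReduction

/-- Assume the OMv conjecture.  Let `ε > 0`, let `α ≥ 1` be a function of `n`, let all numbers have at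
most `a * (⌊log₂ n⌋ + 1)` bits (`a ≥ 1`) and let `k ≥ 2`.  There is no `α`-approximate TreeFlow data
structure with preprocessing time `O(n ^ (3 - ε))` and time `O(n ^ (1 - ε))` for each of the two
operations whose error probability over every sequence of at most `n ^ k` operations is at most
`1 / 3`, in the word RAM with `O(log n)`-bit words. -/
theorem mainTheorem6 (hOMv : OMvConjecture) (ε : ℝ) (hε : 0 < ε) (α : ℕ → ℝ) (hα : ∀ n, 1 ≤ α n)
    (a : ℕ) (ha : 1 ≤ a) (k : ℕ) (hk : 2 ≤ k) :
    ¬ ∃ (D : TreeFlowDS) (c : ℕ) (C : ℝ), D.Implements a k α ε c C := by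
  rintro ⟨D, c, C, hD⟩
  exact hOMv (min ε 1) (lt_min hε one_pos)
    ⟨_, _, _, OMvReduction.solves_alg ha hk hα hε hD⟩
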